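/- Let $n\ge 1$, $\gamma\in(-\frac1n,0)$ and $s=\frac{\gamma}{1+\gamma n}$. Let $V,\varphi:\mathbb R^n\to[0,\infty)$ be convex with $\lim_{|z|\to\infty}V(z)/|z|=+\infty$. Assume that $\varphi$ is of class $C^2$, that $\operatorname{Hess}\varphi(z)$ is invertible for almost every $z$, and that $\int_{\mathbb R^n}\varphi^{1/\gamma}\,dz<\infty$ (where $0^{1/\gamma}=+\infty$). Set $$d\mu(z)=\frac{\varphi(z)^{1/\gamma}}{\int_{\mathbb R^n}\varphi^{1/\gamma}}\,dz,\qquad G=\frac{V(\nabla\varphi)}{\varphi}.$$ Then $$\operatorname{Var}_\mu(G)\le-\frac{\gamma}{1-\gamma}\int_{\mathbb R^n}\frac{\langle(\operatorname{Hess}\varphi)^{-1}\nabla(G\varphi),\nabla(G\varphi)\rangle}{\varphi}\,d\mu+\frac{\gamma-s}{1-\gamma}\Big(\int_{\mathbb R^n}G\,d\mu\Big)^2 ,$$ where $\langle\cdot,\cdot\rangle$ is the Euclidean scalar product and the gradient of $G\varphi=V(\nabla\varphi)$ is taken at almost every point. Both sides are in $[0,\infty]$ (all integrands are non-negative almost everywhere,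 and nothing is claimed when $\int G\,d\mu=\infty$, since then the right-hand side is $\infty$); in particular, if the right-hand side is finite then $G\in L^2(\mu)$. -/

import Mathlib

open MeasureTheory ProbabilityTheory Filter Topology
open scoped ENNReal

noncomputable section

/-- The Hessian of `φ` at `z`, as the linear operator `D(∇φ)(z)` on Euclidean space. -/
def hess {n : ℕ} (φ : EuclideanSpace ℝ (Fin n) → ℝ) (z : EuclideanSpace ℝ (Fin n)) :
    EuclideanSpace ℝ (Fin n) →L[ℝ] EuclideanSpace ℝ (Fin n) :=
  fderiv ℝ (gradient φ) z

/-- The weight `φ ^ (1 / γ)` with values in `[0, ∞]`; for `γ < 0` it is `∞` where `φ = 0`. -/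
def weight {n : ℕ} (γ : ℝ) (φ : EuclideanSpace ℝ (Fin n) → ℝ)
    (z : EuclideanSpace ℝ (Fin n)) : ℝ≥0∞ :=
  ENNReal.ofReal (φ z) ^ (1 / γ)

/-- The normalized measure `dμ = φ ^ (1 / γ) dz / ∫ φ ^ (1 / γ)`. -/
def weightedMeasure {n : ℕ} (γ : ℝ) (φ : EuclideanSpace ℝ (Fin n) → ℝ) :
    Measure (EuclideanSpace ℝ (Fin n)) :=
  (∫⁻ z, weight γ φ z)⁻¹ • volume.withDensity (weight γ φ)

/-- The function `G = V(∇φ) / φ`. -/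
def testFun {n : ℕ} (V φ : EuclideanSpace ℝ (Fin n) → ℝ)
    (z : EuclideanSpace ℝ (Fin n)) : ℝ :=
  V (gradient φ z) / φ z

/-- The energy density `⟨(Hess φ)⁻¹ ∇(G φ), ∇(G φ)⟩ / φ`. -/
def energyDensity {n : ℕ} (φ G : EuclideanSpace ℝ (Fin n) → ℝ)
    (z : EuclideanSpace ℝ (Fin n)) : ℝ :=
  inner ℝ ((hess φ z).inverse (gradient (fun x => G x * φ x) z))
    (gradient (fun x => G x * φ x) z) / φ z

end

/-!
The inequality is the second-order form of the Borell–Brascamp–Lieb inequality. Put `β = -1 / γ`,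
so that `β > n` and `s = -1 / (β - n)`. If `Φ : ℝ × ℝⁿ → [0, ∞]` is jointly convex, then
`t ↦ (∫ Φ(t, z) ^ (-β) dz) ^ (-1 / (β - n))` is convex (`ConvexENN.marginal_euclideanSpace`). This
is proved by integrating out one variable at a time; the one-dimensional case
(`borell_brascamp_lieb_real`) compares superlevel sets, which are intervals, after normalizing
each function by its infimum.

Write `g = V ∘ ∇φ`. On a closed ball `K`, the inequality is applied to
`Φ(t, z) = sup_{x ∈ K} (φ x + ⟪∇φ x, z - x⟫ - t * g x)` for `z ∈ K`, and `Φ = ∞` elsewhere. As a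
supremum of affine functions of `(t, z)` it is jointly convex, for both signs of `t`, and
`Φ(0, ·) = φ` on `K`. It expands as `Φ(t, z) = φ z - t * g z + t ^ 2 * r_t z` with `r_t ≥ 0`, where

* `r_t` is bounded uniformly on `K` (`exists_neg_bregman_sub_le`): the Bregman divergence of `φ`
  controls the squared distance of gradients, and `g` is a Lipschitz function of the gradient, so
  no lower bound on the Hessian is needed;
* `limsup r_t ≤ ⟪(Hess φ)⁻¹ ∇g, ∇g⟫ / 2` wherever the Hessian is invertible and `g` is
  differentiable (`eventually_neg_bregman_sub_le`), hence almost everywhere by Rademacher's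
  theorem.

Fatou's lemma turns these facts into a quadratic lower bound in `t` for `∫_K Φ(t, z) ^ (-β) dz`
(`eventually_quadratic_le_integral`). Midpoint convexity at `t = 0` of its power `-1 / (β - n)` then
constrains the second-order coefficient (`second_derivative_le_of_midpoint_convex`), which gives the
inequality on `K` (`brascamp_lieb_compact_real`). Here `φ` has to be bounded away from zero, so it is
applied to `φ + ε`; the limits `ε → 0` and `K ↑ ℝⁿ` are taken together by monotone convergence
(`brascamp_lieb_unnormalized`).
-/

/-! ### The Borell–Brascamp–Lieb inequality for jointly convex families -/

/-- Convexity of a `[0, ∞]`-valued function on a real vector space, with the value `∞` allowed. -/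
def ConvexENN {M : Type*} [AddCommGroup M] [Module ℝ M] (Φ : M → ℝ≥0∞) : Prop :=
  ∀ x y : M, ∀ a b : ℝ, 0 < a → 0 < b → a + b = 1 →
    Φ (a • x + b • y) ≤ ENNReal.ofReal a * Φ x + ENNReal.ofReal b * Φ y

theorem edist_combination_le_volume {I J K : Set ℝ} (hK : K.OrdConnected) {a b : ℝ}
    (ha : 0 < a) (hb : 0 < b) (h : ∀ x ∈ I, ∀ y ∈ J, a * x + b * y ∈ K)
    {x₁ x₂ y₁ y₂ : ℝ} (hx₁ : x₁ ∈ I) (hx₂ : x₂ ∈ I) (hy₁ : y₁ ∈ J) (hy₂ : y₂ ∈ J) :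
    ENNReal.ofReal a * edist x₁ x₂ + ENNReal.ofReal b * edist y₁ y₂ ≤ volume K := by
  wlog hx : x₁ ≤ x₂ generalizing x₁ x₂
  · rw [edist_comm x₁]; exact this hx₂ hx₁ (le_of_not_ge hx)
  wlog hy : y₁ ≤ y₂ generalizing y₁ y₂
  · rw [edist_comm y₁]; exact this hy₂ hy₁ (le_of_not_ge hy)
  have hsub := hK.out (h _ hx₁ _ hy₁) (h _ hx₂ _ hy₂)
  refine le_trans (le_of_eq ?_) (measure_mono hsub)
  rw [Real.volume_Icc, edist_comm x₁, edist_comm y₁, edist_dist, edist_dist, Real.dist_eq,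
    Real.dist_eq, abs_of_nonneg (sub_nonneg.2 hx), abs_of_nonneg (sub_nonneg.2 hy),
    ← ENNReal.ofReal_mul ha.le, ← ENNReal.ofReal_mul hb.le, ← ENNReal.ofReal_add]
  · congr 1; ring
  · exact mul_nonneg ha.le (sub_nonneg.2 hx)
  · exact mul_nonneg hb.le (sub_nonneg.2 hy)

/-- The one-dimensional Brunn–Minkowski inequality, for a target set that is an interval. -/
theorem volume_combination_le {I J K : Set ℝ} (hI : I.Nonempty) (hJ : J.Nonempty)
    (hK : K.OrdConnected) {a b : ℝ} (ha : 0 < a) (hb : 0 < b)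
    (h : ∀ x ∈ I, ∀ y ∈ J, a * x + b * y ∈ K) :
    ENNReal.ofReal a * volume I + ENNReal.ofReal b * volume J ≤ volume K := by
  have ha' : ENNReal.ofReal a ≠ 0 := by simpa using ha
  have hb' : ENNReal.ofReal b ≠ 0 := by simpa using hb
  have key : ENNReal.ofReal a * Metric.ediam I + ENNReal.ofReal b * Metric.ediam J
      ≤ volume K := by
    have h1 : ∀ y₁ ∈ J, ∀ y₂ ∈ J,
        ENNReal.ofReal a * Metric.ediam I + ENNReal.ofReal b * edist y₁ y₂ ≤ volume K := by
      intro y₁ hy₁ y₂ hy₂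
      have hc : ENNReal.ofReal b * edist y₁ y₂ ≠ ∞ :=
        ENNReal.mul_ne_top ENNReal.ofReal_ne_top (edist_ne_top _ _)
      obtain ⟨x, hx⟩ := hI
      have hle : ENNReal.ofReal b * edist y₁ y₂ ≤ volume K :=
        le_trans le_add_self (edist_combination_le_volume hK ha hb h hx hx hy₁ hy₂)
      refine add_le_of_le_tsub_right_of_le hle ?_
      rw [mul_comm, ← ENNReal.le_div_iff_mul_le (Or.inl ha') (Or.inl ENNReal.ofReal_ne_top)]
      refine Metric.ediam_le fun x₁ hx₁ x₂ hx₂ => ?_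
      rw [ENNReal.le_div_iff_mul_le (Or.inl ha') (Or.inl ENNReal.ofReal_ne_top), mul_comm]
      exact ENNReal.le_sub_of_add_le_right hc
        (edist_combination_le_volume hK ha hb h hx₁ hx₂ hy₁ hy₂)
    by_cases htop : ENNReal.ofReal a * Metric.ediam I = ∞
    · obtain ⟨y, hy⟩ := hJ
      have := h1 y hy y hy
      rw [htop, top_add] at this
      exact le_trans le_top this
    obtain ⟨y, hy⟩ := hJ
    have hle : ENNReal.ofReal a * Metric.ediam I ≤ volume K := le_trans le_self_add (h1 y hy y hy)
    rw [add_comm]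
    refine add_le_of_le_tsub_right_of_le hle ?_
    rw [mul_comm, ← ENNReal.le_div_iff_mul_le (Or.inl hb') (Or.inl ENNReal.ofReal_ne_top)]
    refine Metric.ediam_le fun y₁ hy₁ y₂ hy₂ => ?_
    rw [ENNReal.le_div_iff_mul_le (Or.inl hb') (Or.inl ENNReal.ofReal_ne_top), mul_comm]
    refine ENNReal.le_sub_of_add_le_right htop ?_
    rw [add_comm]
    exact h1 y₁ hy₁ y₂ hy₂
  refine le_trans ?_ key
  gcongr
  · exact Real.volume_le_diam I
  · exact Real.volume_le_diam J

theorem lintegral_eq_lintegral_volume_lt {u : ℝ → ℝ≥0∞} (hu : Measurable u) (hu1 : ∀ x, u x ≤ 1) :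
    ∫⁻ x, u x = ∫⁻ l in Set.Ioi (0 : ℝ), volume {x | ENNReal.ofReal l < u x} := by
  have hfin : ∀ x, u x ≠ ∞ := fun x => ne_top_of_le_ne_top ENNReal.one_ne_top (hu1 x)
  have := lintegral_eq_lintegral_meas_lt (volume : Measure ℝ) (f := fun x => (u x).toReal)
    (Eventually.of_forall fun x => ENNReal.toReal_nonneg) hu.ennreal_toReal.aemeasurable
  simp only [ENNReal.ofReal_toReal (hfin _)] at this
  rw [this]
  refine setLIntegral_congr_fun measurableSet_Ioi fun l hl => ?_
  congr 1
  ext x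
  simp only [Set.mem_ofPred_eq]
  rw [ENNReal.ofReal_lt_iff_lt_toReal (le_of_lt hl) (hfin x)]

theorem ofReal_lt_div_rpow_iff {l p : ℝ} (hp : 0 < p) {m v : ℝ≥0∞}
    (hm : m ≠ 0) (hm' : m ≠ ∞) :
    ENNReal.ofReal l < (v / m) ^ (-p) ↔ v < ENNReal.ofReal l ^ (-(1 / p)) * m := by
  rw [← ENNReal.div_lt_iff (Or.inl hm) (Or.inl hm')]
  have hi : v / m = ((v / m) ^ (-p)) ^ (-(1 / p)) := by
    rw [← ENNReal.rpow_mul]; field_simp; simp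
  constructor
  · intro h
    rw [hi, ENNReal.rpow_neg _ (1 / p), ENNReal.rpow_neg _ (1 / p), ENNReal.inv_lt_inv]
    exact ENNReal.rpow_lt_rpow h (by positivity)
  · intro h
    have h2 : ENNReal.ofReal l = (ENNReal.ofReal l ^ (-(1 / p))) ^ (-p) := by
      rw [← ENNReal.rpow_mul]; field_simp; simp
    rw [h2, ENNReal.rpow_neg _ p, ENNReal.rpow_neg _ p, ENNReal.inv_lt_inv]
    exact ENNReal.rpow_lt_rpow h hp

theorem div_rpow_le_one {m v : ℝ≥0∞} {p : ℝ} (hp : 0 < p) (hm : m ≠ 0) (hm' : m ≠ ∞)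
    (h : m ≤ v) : (v / m) ^ (-p) ≤ 1 := by
  rw [ENNReal.rpow_neg, ENNReal.inv_le_one]
  refine ENNReal.one_le_rpow ?_ hp
  rw [ENNReal.le_div_iff_mul_le (Or.inl hm) (Or.inl hm'), one_mul]
  exact h

/-- After normalization by their infima, the functions `f ^ (-p)`, `g ^ (-p)`, `h ^ (-p)` have
superlevel sets at a common level that satisfy the hypotheses of the one-dimensional
Brunn–Minkowski inequality. -/
theorem lintegral_normalized_combination_le {p : ℝ} (hp : 0 < p) {a b : ℝ} (ha : 0 < a)
    (hb : 0 < b)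
    {f g h : ℝ → ℝ≥0∞} (hf : Measurable f) (hg : Measurable g) (hh : Measurable h)
    (hle : ∀ x y, h (a * x + b * y) ≤ ENNReal.ofReal a * f x + ENNReal.ofReal b * g y)
    (hconv : ∀ c, {x | h x < c}.OrdConnected)
    (hf0 : ⨅ x, f x ≠ 0) (hf1 : ⨅ x, f x ≠ ∞) (hg0 : ⨅ x, g x ≠ 0) (hg1 : ⨅ x, g x ≠ ∞) :
    ENNReal.ofReal a * (∫⁻ x, (f x / ⨅ x, f x) ^ (-p)) +
      ENNReal.ofReal b * (∫⁻ x, (g x / ⨅ x, g x) ^ (-p)) ≤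
    ∫⁻ x, (h x / (ENNReal.ofReal a * (⨅ x, f x) + ENNReal.ofReal b * ⨅ x, g x)) ^ (-p) := by
  set m₀ := ⨅ x, f x with hm₀
  set m₁ := ⨅ x, g x with hm₁
  set m := ENNReal.ofReal a * m₀ + ENNReal.ofReal b * m₁ with hm
  have ha' : ENNReal.ofReal a ≠ 0 := by simpa using ha
  have hm0 : m ≠ 0 := by
    simp only [hm, ne_eq, add_eq_zero, mul_eq_zero, not_and_or, not_or]
    exact Or.inl ⟨ha', hf0⟩
  have hmt : m ≠ ∞ := ENNReal.add_ne_top.2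
    ⟨ENNReal.mul_ne_top ENNReal.ofReal_ne_top hf1, ENNReal.mul_ne_top ENNReal.ofReal_ne_top hg1⟩
  have hmf : Measurable fun x => (f x / m₀) ^ (-p) := (hf.div_const _).pow_const _
  have hmg : Measurable fun x => (g x / m₁) ^ (-p) := (hg.div_const _).pow_const _
  have hmh : Measurable fun x => min ((h x / m) ^ (-p)) 1 :=
    ((hh.div_const _).pow_const _).min measurable_const
  have hf1' : ∀ x, (f x / m₀) ^ (-p) ≤ 1 := fun x => div_rpow_le_one hp hf0 hf1 (iInf_le _ x)
  have hg1' : ∀ x, (g x / m₁) ^ (-p) ≤ 1 := fun x => div_rpow_le_one hp hg0 hg1 (iInf_le _ x)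
  refine le_trans ?_ (lintegral_mono (f := fun x => min ((h x / m) ^ (-p)) 1)
    fun x => min_le_left _ _)
  rw [lintegral_eq_lintegral_volume_lt hmf hf1', lintegral_eq_lintegral_volume_lt hmg hg1',
    lintegral_eq_lintegral_volume_lt hmh fun x => min_le_right _ _,
    ← lintegral_const_mul' _ _ ENNReal.ofReal_ne_top,
    ← lintegral_const_mul' _ _ ENNReal.ofReal_ne_top, ← lintegral_add_left]
  swap
  · refine Measurable.const_mul (Antitone.measurable fun l l' hll => measure_mono ?_) _
    intro x hx
    exact lt_of_le_of_lt (ENNReal.ofReal_le_ofReal hll) hx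
  refine setLIntegral_mono' measurableSet_Ioi fun l hl => ?_
  have hl : 0 < l := hl
  rcases lt_or_ge l 1 with h1 | h1
  · have hκ : 1 < ENNReal.ofReal l ^ (-(1 / p)) := by
      rw [ENNReal.rpow_neg, ENNReal.one_lt_inv]
      exact ENNReal.rpow_lt_one (by simpa using h1) (by positivity)
    have hne : ∀ {w : ℝ → ℝ≥0∞}, ⨅ x, w x ≠ 0 → ⨅ x, w x ≠ ∞ →
        ∃ x, w x < ENNReal.ofReal l ^ (-(1 / p)) * ⨅ x, w x := by
      intro w h0 ht
      refine iInf_lt_iff.1 ?_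
      conv_lhs => rw [← one_mul (⨅ x, w x)]
      exact (ENNReal.mul_lt_mul_iff_left h0 ht).2 hκ
    simp only [ofReal_lt_div_rpow_iff hp hf0 hf1, ofReal_lt_div_rpow_iff hp hg0 hg1]
    have hset : {x | ENNReal.ofReal l < min ((h x / m) ^ (-p)) 1} =
        {x | h x < ENNReal.ofReal l ^ (-(1 / p)) * m} := by
      ext x
      have : ENNReal.ofReal l < 1 := by simpa using h1
      simp only [Set.mem_ofPred_eq, lt_min_iff, this, and_true,
        ofReal_lt_div_rpow_iff hp hm0 hmt]
    rw [hset]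
    refine volume_combination_le (hne hf0 hf1) (hne hg0 hg1) (hconv _) ha hb ?_
    intro x hx y hy
    change f x < _ at hx
    change g y < _ at hy
    change h (a * x + b * y) < _
    refine lt_of_le_of_lt (hle x y) ?_
    rw [hm, mul_add, mul_left_comm, mul_left_comm _ (ENNReal.ofReal b)]
    refine ENNReal.add_lt_add ?_ ?_
    · exact (ENNReal.mul_lt_mul_iff_right ha' ENNReal.ofReal_ne_top).2 hx
    · exact (ENNReal.mul_lt_mul_iff_right (by simpa using hb) ENNReal.ofReal_ne_top).2 hy
  · have hl1 : (1 : ℝ≥0∞) ≤ ENNReal.ofReal l := by simpa using h1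
    have e1 : {x | ENNReal.ofReal l < (f x / m₀) ^ (-p)} = ∅ := by
      ext x; simp [(hf1' x).trans hl1]
    have e2 : {x | ENNReal.ofReal l < (g x / m₁) ^ (-p)} = ∅ := by
      ext x; simp [(hg1' x).trans hl1]
    simp only [e1, e2]
    simp

/-- Joint convexity of `(m, X) ↦ m ^ q * X ^ (1 - q)` for `q > 1`: Jensen's inequality for
`x ↦ x ^ q` at the points `mᵢ / Xᵢ`, with weights proportional to `c * X₀` and `d * X₁`. -/
theorem perspective_rpow_convex {q : ℝ} (hq : 1 < q) {c d m₀ m₁ X₀ X₁ : ℝ≥0∞}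
    (hc0 : c ≠ 0) (hd0 : d ≠ 0) (hc : c ≠ ∞) (hd : d ≠ ∞)
    (h0 : m₀ ≠ 0) (h0' : m₀ ≠ ∞) (h1 : m₁ ≠ 0) (h1' : m₁ ≠ ∞) :
    (c * m₀ + d * m₁) ^ q * (c * X₀ + d * X₁) ^ (1 - q) ≤
      c * (m₀ ^ q * X₀ ^ (1 - q)) + d * (m₁ ^ q * X₁ ^ (1 - q)) := by
  have hq0 : 0 < q := by linarith
  have hneg : 1 - q < 0 := by linarith
  have hmt : (c * m₀ + d * m₁) ^ q ≠ ∞ := ENNReal.rpow_ne_top_of_nonneg hq0.le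
    (ENNReal.add_ne_top.2 ⟨ENNReal.mul_ne_top hc h0', ENNReal.mul_ne_top hd h1'⟩)
  by_cases hX0 : X₀ = 0
  · rw [hX0, ENNReal.zero_rpow_of_neg hneg, ENNReal.mul_top, ENNReal.mul_top hc0, top_add]
    · exact le_top
    · simp [h0, h0', hq0]
  by_cases hX1 : X₁ = 0
  · rw [hX1, ENNReal.zero_rpow_of_neg hneg, ENNReal.mul_top, ENNReal.mul_top hd0, add_top]
    · exact le_top
    · simp [h1, h1', hq0]
  by_cases hX0t : X₀ = ∞
  · rw [hX0t, ENNReal.mul_top hc0, top_add, ENNReal.top_rpow_of_neg hneg, mul_zero]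
    exact zero_le
  by_cases hX1t : X₁ = ∞
  · rw [hX1t, ENNReal.mul_top hd0, add_top, ENNReal.top_rpow_of_neg hneg, mul_zero]
    exact zero_le
  set X := c * X₀ + d * X₁ with hX
  have hX' : X ≠ 0 := by
    simp only [hX, ne_eq, add_eq_zero, mul_eq_zero, not_and_or, not_or]
    exact Or.inl ⟨hc0, hX0⟩
  have hXt : X ≠ ∞ := ENNReal.add_ne_top.2 ⟨ENNReal.mul_ne_top hc hX0t, ENNReal.mul_ne_top hd hX1t⟩
  have hw : c * X₀ / X + d * X₁ / X = 1 := by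
    rw [ENNReal.div_add_div_same, ← hX, ENNReal.div_self hX' hXt]
  have hJ := ENNReal.rpow_arith_mean_le_arith_mean2_rpow (c * X₀ / X) (d * X₁ / X)
    (m₀ / X₀) (m₁ / X₁) hw hq.le
  have e : ∀ {c m Y : ℝ≥0∞}, Y ≠ 0 → Y ≠ ∞ → c * Y / X * (m / Y) = c * m / X := by
    intro c m Y hY hYt
    rw [div_eq_mul_inv, div_eq_mul_inv, div_eq_mul_inv,
      show c * Y * X⁻¹ * (m * Y⁻¹) = c * m * X⁻¹ * (Y * Y⁻¹) by ring,
      ENNReal.mul_inv_cancel hY hYt, mul_one]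
  have e2 : ∀ {c m Y : ℝ≥0∞}, Y ≠ 0 → Y ≠ ∞ →
      c * Y / X * (m / Y) ^ q = c * (m ^ q * Y ^ (1 - q)) / X := by
    intro c m Y hY hYt
    rw [ENNReal.div_rpow_of_nonneg _ _ hq0.le, ENNReal.rpow_sub _ _ hY hYt, ENNReal.rpow_one,
      div_eq_mul_inv, div_eq_mul_inv, div_eq_mul_inv, div_eq_mul_inv]
    ring
  rw [e hX0 hX0t, e hX1 hX1t, e2 hX0 hX0t, e2 hX1 hX1t, ENNReal.div_add_div_same,
    ENNReal.div_add_div_same, ENNReal.div_rpow_of_nonneg _ _ hq0.le] at hJ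
  rw [ENNReal.rpow_sub _ _ hX' hXt, ENNReal.rpow_one]
  calc (c * m₀ + d * m₁) ^ q * (X / X ^ q) = (c * m₀ + d * m₁) ^ q / X ^ q * X := by
        rw [div_eq_mul_inv, div_eq_mul_inv]; ring
    _ ≤ _ := by
        refine (mul_le_mul_left hJ X).trans (le_of_eq ?_)
        rw [ENNReal.div_mul_cancel hX' hXt]

theorem mul_rpow_of_ne_zero_ne_top (x : ℝ≥0∞) {y : ℝ≥0∞} (hy : y ≠ 0) (hy' : y ≠ ∞) (z : ℝ) :
    (x * y) ^ z = x ^ z * y ^ z := by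
  by_cases hx : x = ∞
  · exact ENNReal.mul_rpow_of_ne_zero (by simp [hx]) hy z
  · exact ENNReal.mul_rpow_of_ne_top hx hy' z

/-- Scaling out a constant `m` puts the marginal in the form to which
`perspective_rpow_convex` applies. -/
theorem lintegral_rpow_normalize (f : ℝ → ℝ≥0∞) {m : ℝ≥0∞} (hm : m ≠ 0) (hm' : m ≠ ∞) {p : ℝ}
    (hp : 1 < p) :
    (∫⁻ x, f x ^ (-p)) ^ (-(1 / (p - 1))) =
      m ^ (p / (p - 1)) * (∫⁻ x, (f x / m) ^ (-p)) ^ (1 - p / (p - 1)) := by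
  have hp1 : p - 1 ≠ 0 := by linarith
  have h0 : m ^ (-p) ≠ 0 := by simp [ENNReal.rpow_eq_zero_iff, hm, hm']
  have ht : m ^ (-p) ≠ ∞ := by simp [ENNReal.rpow_eq_top_iff, hm, hm']
  have e : ∀ x, f x ^ (-p) = (f x / m) ^ (-p) * m ^ (-p) := fun x => by
    rw [← mul_rpow_of_ne_zero_ne_top _ hm hm', ENNReal.div_mul_cancel hm hm']
  simp_rw [e]
  rw [lintegral_mul_const' _ _ ht, mul_rpow_of_ne_zero_ne_top _ h0 ht, ← ENNReal.rpow_mul,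
    mul_comm]
  congr 2
  · field_simp
  · field_simp; ring

/-- The one-dimensional Borell–Brascamp–Lieb inequality for functions with positive infima. -/
theorem borell_brascamp_lieb_real_aux {p : ℝ} (hp : 1 < p) {a b : ℝ} (ha : 0 < a) (hb : 0 < b)
    {f g h : ℝ → ℝ≥0∞} (hf : Measurable f) (hg : Measurable g) (hh : Measurable h)
    (hle : ∀ x y, h (a * x + b * y) ≤ ENNReal.ofReal a * f x + ENNReal.ofReal b * g y)
    (hconv : ∀ c, {x | h x < c}.OrdConnected)
    (hf0 : ⨅ x, f x ≠ 0) (hg0 : ⨅ x, g x ≠ 0) :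
    (∫⁻ x, h x ^ (-p)) ^ (-(1 / (p - 1))) ≤
      ENNReal.ofReal a * (∫⁻ x, f x ^ (-p)) ^ (-(1 / (p - 1))) +
      ENNReal.ofReal b * (∫⁻ x, g x ^ (-p)) ^ (-(1 / (p - 1))) := by
  have ha' : ENNReal.ofReal a ≠ 0 := by simpa using ha
  have hb' : ENNReal.ofReal b ≠ 0 := by simpa using hb
  have hp1 : 0 < p - 1 := by linarith
  have hs : -(1 / (p - 1)) < 0 := neg_lt_zero.2 (by positivity)
  have htop : ∀ w : ℝ → ℝ≥0∞, ⨅ x, w x = ∞ → (∫⁻ x, w x ^ (-p)) ^ (-(1 / (p - 1))) = ∞ := by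
    intro w hw
    rw [iInf_eq_top] at hw
    simp only [hw]
    rw [ENNReal.top_rpow_of_neg (by linarith), lintegral_zero, ENNReal.zero_rpow_of_neg hs]
  by_cases hf1 : ⨅ x, f x = ∞
  · rw [htop f hf1, ENNReal.mul_top ha', top_add]; exact le_top
  by_cases hg1 : ⨅ x, g x = ∞
  · rw [htop g hg1, ENNReal.mul_top hb', add_top]; exact le_top
  have hm0 : ENNReal.ofReal a * (⨅ x, f x) + ENNReal.ofReal b * ⨅ x, g x ≠ 0 := by
    simp only [ne_eq, add_eq_zero, mul_eq_zero, not_and_or, not_or]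
    exact Or.inl ⟨ha', hf0⟩
  have hmt : ENNReal.ofReal a * (⨅ x, f x) + ENNReal.ofReal b * ⨅ x, g x ≠ ∞ :=
    ENNReal.add_ne_top.2
      ⟨ENNReal.mul_ne_top ENNReal.ofReal_ne_top hf1, ENNReal.mul_ne_top ENNReal.ofReal_ne_top hg1⟩
  have hq : 1 < p / (p - 1) := by rw [lt_div_iff₀ hp1]; linarith
  rw [lintegral_rpow_normalize h hm0 hmt hp, lintegral_rpow_normalize f hf0 hf1 hp,
    lintegral_rpow_normalize g hg0 hg1 hp]
  refine le_trans ?_ (perspective_rpow_convex hq ha' hb' ENNReal.ofReal_ne_top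
    ENNReal.ofReal_ne_top hf0 hf1 hg0 hg1)
  refine mul_le_mul_right ?_ _
  have hA := lintegral_normalized_combination_le (by linarith : 0 < p) ha hb hf hg hh hle hconv
    hf0 hf1 hg0 hg1
  rw [show 1 - p / (p - 1) = -(1 / (p - 1)) by field_simp; ring, ENNReal.rpow_neg,
    ENNReal.rpow_neg, ENNReal.inv_le_inv]
  exact ENNReal.rpow_le_rpow hA (by positivity)

theorem tendsto_lintegral_add_rpow {α : Type*} [MeasurableSpace α] {μ : Measure α}
    {f : α → ℝ≥0∞} (hf : Measurable f) {p : ℝ} (hp : 0 < p) :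
    Tendsto (fun k : ℕ => ∫⁻ x, (f x + (k + 1 : ℝ≥0∞)⁻¹) ^ (-p) ∂μ) atTop
      (𝓝 (∫⁻ x, f x ^ (-p) ∂μ)) := by
  refine lintegral_tendsto_of_tendsto_of_monotone
    (fun k => ((hf.add_const _).pow_const _).aemeasurable) ?_ ?_
  · refine Eventually.of_forall fun x k l hkl => ?_
    simp only [ENNReal.rpow_neg]
    gcongr
  · refine Eventually.of_forall fun x => ?_
    refine (ENNReal.continuous_rpow_const.tendsto _).comp ?_
    conv => rhs; rw [← add_zero (f x)]
    refine Tendsto.const_add _ ?_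
    have := (tendsto_add_atTop_iff_nat 1).2 ENNReal.tendsto_inv_nat_nhds_zero
    simpa using this

/-- The one-dimensional Borell–Brascamp–Lieb inequality, in the range `p > 1`. -/
theorem borell_brascamp_lieb_real {p : ℝ} (hp : 1 < p) {a b : ℝ} (ha : 0 < a) (hb : 0 < b)
    (hab : a + b = 1)
    {f g h : ℝ → ℝ≥0∞} (hf : Measurable f) (hg : Measurable g) (hh : Measurable h)
    (hle : ∀ x y, h (a * x + b * y) ≤ ENNReal.ofReal a * f x + ENNReal.ofReal b * g y)
    (hconv : ∀ c, {x | h x < c}.OrdConnected) :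
    (∫⁻ x, h x ^ (-p)) ^ (-(1 / (p - 1))) ≤
      ENNReal.ofReal a * (∫⁻ x, f x ^ (-p)) ^ (-(1 / (p - 1))) +
      ENNReal.ofReal b * (∫⁻ x, g x ^ (-p)) ^ (-(1 / (p - 1))) := by
  have hp1 : 0 < p - 1 := by linarith
  -- It suffices to add a small constant to all three functions and to let it tend to zero.
  have hlim : ∀ w : ℝ → ℝ≥0∞, Measurable w → Tendsto
      (fun k : ℕ => (∫⁻ x, (w x + (k + 1 : ℝ≥0∞)⁻¹) ^ (-p)) ^ (-(1 / (p - 1)))) atTop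
      (𝓝 ((∫⁻ x, w x ^ (-p)) ^ (-(1 / (p - 1))))) := fun w hw =>
    (ENNReal.continuous_rpow_const.tendsto _).comp (tendsto_lintegral_add_rpow hw (by linarith))
  refine le_of_tendsto_of_tendsto' (hlim h hh)
    ((ENNReal.Tendsto.const_mul (hlim f hf) (Or.inr ENNReal.ofReal_ne_top)).add
      (ENNReal.Tendsto.const_mul (hlim g hg) (Or.inr ENNReal.ofReal_ne_top))) fun k => ?_
  have hc0 : (k + 1 : ℝ≥0∞)⁻¹ ≠ 0 := by
    rw [ne_eq, ENNReal.inv_eq_zero]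
    exact ENNReal.add_ne_top.2 ⟨ENNReal.natCast_ne_top k, ENNReal.one_ne_top⟩
  set c : ℝ≥0∞ := (k + 1 : ℝ≥0∞)⁻¹ with hc
  have hct : c ≠ ∞ := by simp [hc]
  have hinf : ∀ w : ℝ → ℝ≥0∞, ⨅ x, (w x + c) ≠ 0 := fun w h0 =>
    hc0 (le_antisymm (h0 ▸ le_iInf fun x => le_add_self) zero_le)
  refine borell_brascamp_lieb_real_aux hp ha hb (hf.add_const _) (hg.add_const _)
    (hh.add_const _) (fun x y => ?_) (fun d => ?_) (hinf f) (hinf g)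
  · have : ENNReal.ofReal a * c + ENNReal.ofReal b * c = c := by
      rw [← add_mul, ← ENNReal.ofReal_add ha.le hb.le, hab, ENNReal.ofReal_one, one_mul]
    calc h (a * x + b * y) + c
        ≤ ENNReal.ofReal a * f x + ENNReal.ofReal b * g y +
          (ENNReal.ofReal a * c + ENNReal.ofReal b * c) := by rw [this]; gcongr; exact hle x y
      _ = _ := by ring
  · have : {x | h x + c < d} = {x | h x < d - c} := by
      ext x
      exact (lt_tsub_iff_right (a := h x) (b := d) (c := c)).symm
    rw [this]
    exact hconv _

theorem ConvexENN.ordConnected_lt {f : ℝ → ℝ≥0∞} (hf : ConvexENN f) (c : ℝ≥0∞) :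
    {x | f x < c}.OrdConnected := by
  refine Convex.ordConnected (convex_iff_forall_pos.2 fun x hx y hy a b ha hb hab => ?_)
  change f x < c at hx
  change f y < c at hy
  refine lt_of_le_of_lt (hf x y a b ha hb hab) ?_
  refine lt_of_lt_of_eq (ENNReal.add_lt_add
    ((ENNReal.mul_lt_mul_iff_right (by simpa using ha) ENNReal.ofReal_ne_top).2 hx)
    ((ENNReal.mul_lt_mul_iff_right (by simpa using hb) ENNReal.ofReal_ne_top).2 hy)) ?_
  rw [← add_mul, ← ENNReal.ofReal_add ha.le hb.le, hab, ENNReal.ofReal_one, one_mul]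

/-- Integrating out one real variable of a jointly convex function preserves convexity. -/
theorem ConvexENN.marginal_real {M : Type*} [AddCommGroup M] [Module ℝ M] [MeasurableSpace M]
    {Φ : M × ℝ → ℝ≥0∞} (hΦ : ConvexENN Φ) (hm : Measurable Φ) {p : ℝ} (hp : 1 < p) :
    ConvexENN fun x => (∫⁻ y, Φ (x, y) ^ (-p)) ^ (-(1 / (p - 1))) := by
  intro x y a b ha hb hab
  refine borell_brascamp_lieb_real hp ha hb hab (f := fun r => Φ (x, r)) (g := fun r => Φ (y, r))
    (h := fun r => Φ (a • x + b • y, r))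
    (by fun_prop) (by fun_prop) (by fun_prop) (fun r r' => ?_) (fun c => ?_)
  · exact hΦ (x, r) (y, r') a b ha hb hab
  · refine ConvexENN.ordConnected_lt (fun r r' u v hu hv huv => ?_) c
    have := hΦ (a • x + b • y, r) (a • x + b • y, r') u v hu hv huv
    rw [Prod.smul_mk, Prod.smul_mk, Prod.mk_add_mk, ← add_smul, huv, one_smul] at this
    exact this

/-- Integrating out finitely many real variables of a jointly convex function preserves
convexity: the Borell–Brascamp–Lieb inequality for jointly convex families. The exponent drops
by one with every variable. -/
theorem ConvexENN.marginal_pi {n : ℕ} {p : ℝ} (hp : n < p) {Φ : ℝ × (Fin n → ℝ) → ℝ≥0∞}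
    (hΦ : ConvexENN Φ) (hm : Measurable Φ) :
    ConvexENN fun t => (∫⁻ y, Φ (t, y) ^ (-p)) ^ (-(1 / (p - n))) := by
  induction n generalizing p with
  | zero =>
    intro x y a b ha hb hab
    have hp0 : p ≠ 0 := by
      have : (0 : ℝ) < p := by simpa using hp
      exact this.ne'
    have e : ∀ t, (∫⁻ y, Φ (t, y) ^ (-p)) ^ (-(1 / (p - (0 : ℕ)))) = Φ (t, default) := by
      intro t
      rw [lintegral_unique, volume_pi, Measure.pi_univ]
      simp only [Finset.univ_eq_empty, Finset.prod_empty, mul_one]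
      rw [← ENNReal.rpow_mul]
      simp only [CharP.cast_eq_zero, sub_zero]
      rw [show -p * -(1 / p) = 1 by field_simp, ENNReal.rpow_one]
      exact congrArg Φ (Prod.ext rfl (Subsingleton.elim _ _))
    simp only [e]
    have := hΦ (x, default) (y, default) a b ha hb hab
    convert this using 2
    exact Prod.ext rfl (Subsingleton.elim _ _)
  | succ n ih =>
    have hp' : (n : ℝ) + 1 < p := by exact_mod_cast hp
    have hn : (0 : ℝ) ≤ n := n.cast_nonneg
    set ψ : ℝ × (Fin n → ℝ) → ℝ≥0∞ := fun z =>
      (∫⁻ r : ℝ, Φ (z.1, Fin.cons r z.2) ^ (-p)) ^ (-(1 / (p - 1))) with hψ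
    have hcons : Measurable fun z : (ℝ × (Fin n → ℝ)) × ℝ => (z.1.1, (Fin.cons z.2 z.1.2 :
        Fin (n + 1) → ℝ)) := by
      refine Measurable.prodMk (by fun_prop) (measurable_pi_iff.2 fun i => ?_)
      refine Fin.cases ?_ (fun j => ?_) i
      · simpa using measurable_snd
      · simp only [Fin.cons_succ]; fun_prop
    have hψc : ConvexENN ψ := by
      refine ConvexENN.marginal_real (Φ := fun z : (ℝ × (Fin n → ℝ)) × ℝ =>
        Φ (z.1.1, Fin.cons z.2 z.1.2)) ?_ (hm.comp hcons) (by linarith)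
      intro x y a b ha hb hab
      have := hΦ (x.1.1, Fin.cons x.2 x.1.2) (y.1.1, Fin.cons y.2 y.1.2) a b ha hb hab
      convert this using 2
      refine Prod.ext rfl ?_
      ext i
      refine Fin.cases ?_ (fun j => ?_) i <;> simp
    have hψm : Measurable ψ := by
      refine Measurable.pow_const (Measurable.lintegral_prod_right'
        (f := fun z : (ℝ × (Fin n → ℝ)) × ℝ => Φ (z.1.1, Fin.cons z.2 z.1.2) ^ (-p)) ?_) _
      exact (hm.comp hcons).pow_const _
    have := ih (p := p - 1) (by linarith) hψc hψm
    convert this using 3 with t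
    · have hmp := (volume_preserving_piFinSuccAbove (fun _ : Fin (n + 1) => ℝ) 0).symm
      rw [← hmp.lintegral_comp_emb (MeasurableEquiv.measurableEmbedding _)]
      rw [Measure.volume_eq_prod, lintegral_prod_symm']
      · refine lintegral_congr fun y => ?_
        simp only [hψ]
        rw [← ENNReal.rpow_mul, show -(1 / (p - 1)) * -(p - 1) = 1 by
          have : p - 1 ≠ 0 := by linarith
          field_simp, ENNReal.rpow_one]
        simp [MeasurableEquiv.piFinSuccAbove, Fin.insertNthEquiv]
      · refine Measurable.pow_const (hm.comp ?_) _
        exact measurable_const.prodMk (MeasurableEquiv.measurable _)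
    · push_cast; ring

/-- The Borell–Brascamp–Lieb inequality for jointly convex families on Euclidean space. -/
theorem ConvexENN.marginal_euclideanSpace {n : ℕ} {p : ℝ} (hp : n < p)
    {Φ : ℝ × EuclideanSpace ℝ (Fin n) → ℝ≥0∞} (hΦ : ConvexENN Φ) (hm : Measurable Φ) :
    ConvexENN fun t => (∫⁻ y, Φ (t, y) ^ (-p)) ^ (-(1 / (p - n))) := by
  have hmp := EuclideanSpace.volume_preserving_symm_measurableEquiv_toLp (Fin n)
  have := ConvexENN.marginal_pi hp (Φ := fun z => Φ (z.1, WithLp.toLp 2 z.2)) ?_ ?_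
  · convert this using 3 with t
    rw [← hmp.lintegral_comp_emb (MeasurableEquiv.measurableEmbedding _)]
    rfl
  · intro x y a b ha hb hab
    exact hΦ (x.1, WithLp.toLp 2 x.2) (y.1, WithLp.toLp 2 y.2) a b ha hb hab
  · refine hm.comp (measurable_fst.prodMk ?_)
    exact (MeasurableEquiv.toLp 2 (Fin n → ℝ)).measurable.comp measurable_snd

/-! ### Positive semidefinite operators -/

section Operator

variable {E : Type*} [NormedAddCommGroup E] [InnerProductSpace ℝ E]

/-- Maximization of a concave quadratic function: the value of the Legendre transform of
`u ↦ ⟪H u, u⟫ / 2` at `-b` is `⟪H⁻¹ b, b⟫ / 2`. -/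
theorem neg_quadratic_sub_linear_le {H : E →L[ℝ] E} (hsymm : ∀ v w, inner ℝ (H v) w = inner ℝ (H w) v)
    (hpos : ∀ v, 0 ≤ inner ℝ (H v) v) (hinv : H.IsInvertible) (b u : E) :
    -(1 / 2 * inner ℝ (H u) u) - inner ℝ b u ≤ 1 / 2 * inner ℝ (H.inverse b) b := by
  obtain ⟨e, rfl⟩ := hinv
  rw [ContinuousLinearMap.inverse_equiv]
  set w := e.symm b with hw
  have hb : b = e w := by simp [hw]
  have h := hpos (u + w)
  have hs := hsymm u w
  simp only [map_add, inner_add_left, inner_add_right, ContinuousLinearEquiv.coe_coe] at h hs ⊢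
  rw [← hw, hb, real_inner_comm w (e w)] at *
  have : inner ℝ w (e w) = inner ℝ (e w) w := real_inner_comm _ _
  linarith

/-- A form of the Cauchy–Schwarz inequality for the semidefinite form `⟪H v, w⟫`. -/
theorem norm_sq_apply_le {H : E →L[ℝ] E} (hsymm : ∀ v w, inner ℝ (H v) w = inner ℝ (H w) v)
    (hpos : ∀ v, 0 ≤ inner ℝ (H v) v) (v : E) :
    ‖H v‖ ^ 2 ≤ (‖H‖ + 1) * inner ℝ (H v) v := by
  set N := ‖H‖ + 1 with hN
  have hN0 : 0 < N := by positivity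
  -- Evaluating the form at `N • v - H v` with `N ≥ ‖H‖` yields the bound with constant `N`.
  have h := hpos (N • v - H v)
  have hs := hsymm v (H v)
  have hH : inner ℝ (H (H v)) (H v) ≤ N * ‖H v‖ ^ 2 := by
    calc inner ℝ (H (H v)) (H v) ≤ ‖H (H v)‖ * ‖H v‖ := real_inner_le_norm _ _
      _ ≤ (‖H‖ * ‖H v‖) * ‖H v‖ := by gcongr; exact H.le_opNorm _
      _ ≤ N * ‖H v‖ ^ 2 := by nlinarith [sq_nonneg ‖H v‖]
  simp only [map_sub, map_smul, inner_sub_left, inner_sub_right, inner_smul_left, inner_smul_right,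
    conj_trivial] at h
  rw [← hs, real_inner_self_eq_norm_sq] at h
  have : 0 ≤ N * (N * inner ℝ (H v) v - ‖H v‖ ^ 2) := by nlinarith
  nlinarith [(mul_nonneg_iff_of_pos_left hN0).1 this]

/-- An invertible symmetric positive semidefinite operator is coercive. -/
theorem exists_coercive {H : E →L[ℝ] E} (hsymm : ∀ v w, inner ℝ (H v) w = inner ℝ (H w) v)
    (hpos : ∀ v, 0 ≤ inner ℝ (H v) v) (hinv : H.IsInvertible) :
    ∃ c > 0, ∀ v, c * ‖v‖ ^ 2 ≤ inner ℝ (H v) v := by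
  obtain ⟨e, he⟩ := hinv
  set S := ‖(e.symm : E →L[ℝ] E)‖ + 1 with hS
  have hS0 : 0 < S := by positivity
  refine ⟨1 / (S ^ 2 * (‖H‖ + 1)), by positivity, fun v => ?_⟩
  have h1 : ‖v‖ ≤ S * ‖H v‖ := by
    have : ‖(e.symm : E →L[ℝ] E) (H v)‖ ≤ ‖(e.symm : E →L[ℝ] E)‖ * ‖H v‖ :=
      ContinuousLinearMap.le_opNorm _ _
    have h2 : (e.symm : E →L[ℝ] E) (H v) = v := by rw [← he]; simp
    rw [h2] at this
    nlinarith [norm_nonneg (H v)]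
  have h2 := norm_sq_apply_le hsymm hpos v
  rw [one_div, inv_mul_le_iff₀ (by positivity)]
  calc ‖v‖ ^ 2 ≤ (S * ‖H v‖) ^ 2 := by gcongr
    _ = S ^ 2 * ‖H v‖ ^ 2 := by ring
    _ ≤ S ^ 2 * ((‖H‖ + 1) * inner ℝ (H v) v) := by gcongr
    _ = _ := by ring

end Operator

/-! ### The Bregman divergence of a convex function -/

section Bregman

variable {n : ℕ}

/-- The Bregman divergence of `φ`: the gap at `z` between `φ` and its tangent function at `x`. -/
noncomputable def bregman (φ : EuclideanSpace ℝ (Fin n) → ℝ) (z x : EuclideanSpace ℝ (Fin n)) : ℝ :=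
  φ z - (φ x + inner ℝ (gradient φ x) (z - x))

variable {φ : EuclideanSpace ℝ (Fin n) → ℝ}

theorem contDiff_gradient (hφ : ContDiff ℝ 2 φ) : ContDiff ℝ 1 (gradient φ) :=
  (InnerProductSpace.toDual ℝ (EuclideanSpace ℝ (Fin n))).symm.contDiff.comp
    (hφ.fderiv_right (m := 1) (by norm_num))

theorem inner_gradient_eq_fderiv (φ : EuclideanSpace ℝ (Fin n) → ℝ)
    (x v : EuclideanSpace ℝ (Fin n)) : inner ℝ (gradient φ x) v = fderiv ℝ φ x v := by
  simp [gradient, InnerProductSpace.toDual_symm_apply]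

theorem hasFDerivAt_gradient (hφ : ContDiff ℝ 2 φ) (z : EuclideanSpace ℝ (Fin n)) :
    HasFDerivAt (gradient φ) (hess φ z) z :=
  ((contDiff_gradient hφ).differentiable (by norm_num) z).hasFDerivAt

theorem inner_hess_eq (hφ : ContDiff ℝ 2 φ) (z v w : EuclideanSpace ℝ (Fin n)) :
    inner ℝ (hess φ z v) w = fderiv ℝ (fderiv ℝ φ) z v w := by
  have h1 : HasFDerivAt (fun x => inner ℝ (gradient φ x) w)
      ((innerSL ℝ w).comp (hess φ z)) z := by
    have := (innerSL ℝ w).hasFDerivAt.comp z (hasFDerivAt_gradient hφ z)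
    refine this.congr_of_eventuallyEq (Eventually.of_forall fun x => ?_)
    simp
  have h2 : HasFDerivAt (fun x => fderiv ℝ φ x w)
      ((ContinuousLinearMap.apply ℝ ℝ w).comp (fderiv ℝ (fderiv ℝ φ) z)) z :=
    (ContinuousLinearMap.apply ℝ ℝ w).hasFDerivAt.comp z
      (((hφ.fderiv_right (m := 1) (by norm_num)).differentiable (by norm_num) z).hasFDerivAt)
  simp only [inner_gradient_eq_fderiv] at h1
  have := congrArg (fun L : EuclideanSpace ℝ (Fin n) →L[ℝ] ℝ => L v) (h1.unique h2)
  simpa [real_inner_comm] using this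

theorem hess_symm (hφ : ContDiff ℝ 2 φ) (z v w : EuclideanSpace ℝ (Fin n)) :
    inner ℝ (hess φ z v) w = inner ℝ (hess φ z w) v := by
  rw [inner_hess_eq hφ, inner_hess_eq hφ]
  exact (hφ.contDiffAt.isSymmSndFDerivAt (by simp)).eq v w

theorem hasDerivAt_line (hφ : Differentiable ℝ φ) (x v : EuclideanSpace ℝ (Fin n)) (r : ℝ) :
    HasDerivAt (fun r : ℝ => φ (x + r • v)) (inner ℝ (gradient φ (x + r • v)) v) r := by
  rw [inner_gradient_eq_fderiv]
  have h := (hφ (x + r • v)).hasFDerivAt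
  have h2 : HasDerivAt (fun r : ℝ => x + r • v) v r := by
    simpa using ((hasDerivAt_id r).smul_const v).const_add x
  exact h.comp_hasDerivAt r h2

theorem bregman_nonneg (hφ : Differentiable ℝ φ) (hc : ConvexOn ℝ Set.univ φ)
    (z x : EuclideanSpace ℝ (Fin n)) : 0 ≤ bregman φ z x := by
  have hd := hasDerivAt_line hφ x (z - x) 0
  have hcl : ConvexOn ℝ Set.univ (fun r : ℝ => φ (x + r • (z - x))) := by
    refine ⟨convex_univ, fun r _ r' _ a b ha hb hab => ?_⟩
    have := hc.2 (Set.mem_univ (x + r • (z - x))) (Set.mem_univ (x + r' • (z - x))) ha hb hab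
    refine le_trans (le_of_eq (congrArg φ ?_)) this
    have : x = a • x + b • x := by rw [← add_smul, hab, one_smul]
    nth_rewrite 1 [this]
    simp only [smul_eq_mul]
    module
  have := hcl.deriv_le_slope (Set.mem_univ 0) (Set.mem_univ 1) one_pos hd.differentiableAt
  rw [hd.deriv, slope_def_field] at this
  simp only [zero_smul, add_zero, one_smul, add_sub_cancel, sub_zero, div_one] at this
  unfold bregman
  linarith

theorem gradient_monotone (hφ : Differentiable ℝ φ) (hc : ConvexOn ℝ Set.univ φ)
    (z x : EuclideanSpace ℝ (Fin n)) : 0 ≤ inner ℝ (gradient φ z - gradient φ x) (z - x) := by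
  have h1 := bregman_nonneg hφ hc z x
  have h2 := bregman_nonneg hφ hc x z
  unfold bregman at h1 h2
  rw [← neg_sub z x, inner_neg_right] at h2
  rw [inner_sub_left]
  linarith

theorem bregman_le_inner (hφ : Differentiable ℝ φ) (hc : ConvexOn ℝ Set.univ φ)
    (z x : EuclideanSpace ℝ (Fin n)) :
    bregman φ z x ≤ inner ℝ (gradient φ z - gradient φ x) (z - x) := by
  have h2 := bregman_nonneg hφ hc x z
  unfold bregman at h2 ⊢
  rw [← neg_sub z x, inner_neg_right] at h2
  rw [inner_sub_left]
  linarith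

/-- The three-point identity for the Bregman divergence. -/
theorem bregman_three_points (w z x : EuclideanSpace ℝ (Fin n)) :
    bregman φ w x = bregman φ w z + bregman φ z x +
      inner ℝ (gradient φ z - gradient φ x) (w - z) := by
  unfold bregman
  rw [inner_sub_left, show w - x = (w - z) + (z - x) by abel, inner_add_right]
  ring

/-- Local cocoercivity of the gradient of a convex function: on bounded sets, the Bregman
divergence controls the squared distance of the gradients. No lower bound on the Hessian is
needed. -/
theorem exists_norm_gradient_sub_sq_le_bregman (hφ : ContDiff ℝ 2 φ)
    (hc : ConvexOn ℝ Set.univ φ) (R : ℝ) :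
    ∃ M > 0, ∀ z ∈ Metric.closedBall (0 : EuclideanSpace ℝ (Fin n)) R,
      ∀ x ∈ Metric.closedBall (0 : EuclideanSpace ℝ (Fin n)) R,
      ‖gradient φ z - gradient φ x‖ ^ 2 ≤ M * bregman φ z x := by
  have hd := hφ.differentiable (by norm_num)
  have hgr := contDiff_gradient hφ
  obtain ⟨C, hC⟩ := (hgr.locallyLipschitz.locallyLipschitzOn
    (s := Metric.closedBall 0 (R + 1))).exists_lipschitzOnWith_of_compact
    (isCompact_closedBall (0 : EuclideanSpace ℝ (Fin n)) (R + 1))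
  obtain ⟨B, hB⟩ := (isCompact_closedBall (0 : EuclideanSpace ℝ (Fin n)) R).exists_bound_of_continuousOn
    (f := gradient φ) hgr.continuous.continuousOn
  set L : ℝ := C + 2 * |B| + 1 with hL
  have hL0 : 0 < L := by positivity
  refine ⟨4 * L, by positivity, fun z hz x hx => ?_⟩
  set v := gradient φ z - gradient φ x with hv
  have hvB : ‖v‖ ≤ 2 * |B| := by
    calc ‖v‖ ≤ ‖gradient φ z‖ + ‖gradient φ x‖ := norm_sub_le _ _
      _ ≤ 2 * |B| := by linarith [hB z hz, hB x hx, le_abs_self B]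
  -- One gradient step from `z` for the function `bregman φ · x`, which stays nonnegative.
  set w := z - (1 / (2 * L)) • v with hw
  have hwz : w - z = -((1 / (2 * L)) • v) := by rw [hw]; abel
  have hwR : w ∈ Metric.closedBall (0 : EuclideanSpace ℝ (Fin n)) (R + 1) := by
    rw [mem_closedBall_zero_iff] at hz ⊢
    calc ‖w‖ ≤ ‖z‖ + ‖(1 / (2 * L)) • v‖ := norm_sub_le _ _
      _ ≤ R + 1 := by
        refine add_le_add hz ?_
        rw [norm_smul, Real.norm_of_nonneg (by positivity), one_div, inv_mul_le_iff₀ (by positivity)]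
        have : (0 : ℝ) ≤ C := C.2
        linarith [abs_nonneg B]
  have hzR : z ∈ Metric.closedBall (0 : EuclideanSpace ℝ (Fin n)) (R + 1) :=
    Metric.closedBall_subset_closedBall (by linarith) hz
  have h1 : bregman φ w z ≤ L * ‖w - z‖ ^ 2 := by
    calc bregman φ w z ≤ inner ℝ (gradient φ w - gradient φ z) (w - z) := bregman_le_inner hd hc w z
      _ ≤ ‖gradient φ w - gradient φ z‖ * ‖w - z‖ := real_inner_le_norm _ _
      _ ≤ (C * ‖w - z‖) * ‖w - z‖ := by
        gcongr
        have := hC.dist_le_mul w hwR z hzR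
        rwa [dist_eq_norm, dist_eq_norm] at this
      _ ≤ L * ‖w - z‖ ^ 2 := by nlinarith [sq_nonneg ‖w - z‖, abs_nonneg B]
  have h2 := bregman_nonneg hd hc w x
  rw [bregman_three_points w z x, hwz, inner_neg_right, inner_smul_right,
    real_inner_self_eq_norm_sq, ← hv] at h2
  rw [hwz, norm_neg, norm_smul, Real.norm_of_nonneg (by positivity)] at h1
  have h3 : L * (1 / (2 * L) * ‖v‖) ^ 2 = ‖v‖ ^ 2 / (4 * L) := by field_simp; ring
  have h4 : 1 / (2 * L) * ‖v‖ ^ 2 = 2 * (‖v‖ ^ 2 / (4 * L)) := by field_simp; ring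
  have h5 : ‖v‖ ^ 2 / (4 * L) ≤ bregman φ z x := by linarith
  rwa [div_le_iff₀ (by positivity), mul_comm] at h5

/-- The Bregman divergence grows along rays issued from its first argument. -/
theorem bregman_ray_mono (hφ : Differentiable ℝ φ) (hc : ConvexOn ℝ Set.univ φ)
    (z y : EuclideanSpace ℝ (Fin n)) {r : ℝ} (hr0 : 0 ≤ r) (hr1 : r ≤ 1) :
    bregman φ z (z + r • y) ≤ bregman φ z (z + y) := by
  rcases hr1.eq_or_lt with rfl | hr1
  · rw [one_smul]
  rw [bregman_three_points z (z + r • y) (z + y)]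
  have h1 := bregman_nonneg hφ hc (z + r • y) (z + y)
  have h2 := gradient_monotone hφ hc (z + r • y) (z + y)
  rw [show z + r • y - (z + y) = (r - 1) • y by module, inner_smul_right] at h2
  rw [show z - (z + r • y) = (-r) • y by module, inner_smul_right]
  have h3 : inner ℝ (gradient φ (z + r • y) - gradient φ (z + y)) y ≤ 0 := by nlinarith
  nlinarith

theorem hess_nonneg (hφ : ContDiff ℝ 2 φ) (hc : ConvexOn ℝ Set.univ φ)
    (z v : EuclideanSpace ℝ (Fin n)) : 0 ≤ inner ℝ (hess φ z v) v := by
  have hd := hφ.differentiable (by norm_num)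
  have h2 : HasDerivAt (fun r : ℝ => gradient φ (z + r • v)) (hess φ z v) 0 := by
    have h := hasFDerivAt_gradient hφ z
    have hl : HasDerivAt (fun r : ℝ => z + r • v) v 0 := by
      simpa using ((hasDerivAt_id (0 : ℝ)).smul_const v).const_add z
    have h' : HasFDerivAt (gradient φ) (hess φ z) (z + (0 : ℝ) • v) := by simpa using h
    exact h'.comp_hasDerivAt 0 hl
  have h3 := (h2.inner ℝ (hasDerivAt_const (0 : ℝ) v))
  simp only [inner_zero_right, zero_add] at h3
  have hmono : Monotone fun r : ℝ => inner ℝ (gradient φ (z + r • v)) v := by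
    intro r r' hrr
    rcases hrr.eq_or_lt with rfl | hlt
    · exact le_rfl
    have := gradient_monotone hd hc (z + r' • v) (z + r • v)
    rw [show z + r' • v - (z + r • v) = (r' - r) • v by module, inner_smul_right,
      inner_sub_left] at this
    have := (mul_nonneg_iff_of_pos_left (sub_pos.2 hlt)).1 this
    simpa using this
  rw [← h3.deriv]
  exact hmono.deriv_nonneg

end Bregman

/-! ### Second-order expansion of the Bregman gap -/

section Expansion

variable {n : ℕ} {φ : EuclideanSpace ℝ (Fin n) → ℝ}

/-- Second-order Taylor expansion of the Bregman divergence in its second argument, as a lower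
bound. -/
theorem exists_quadratic_le_bregman (hφ : ContDiff ℝ 2 φ) (z : EuclideanSpace ℝ (Fin n))
    {η : ℝ} (hη : 0 < η) :
    ∃ δ > 0, ∀ y : EuclideanSpace ℝ (Fin n), ‖y‖ ≤ δ →
      1 / 2 * inner ℝ (hess φ z y) y - η * ‖y‖ ^ 2 ≤ bregman φ z (z + y) := by
  have hd := hφ.differentiable (by norm_num)
  have ho := (hasFDerivAt_iff_isLittleO_nhds_zero.1 (hasFDerivAt_gradient hφ z)).def
    (half_pos hη)
  obtain ⟨δ, hδ, hball⟩ := Metric.eventually_nhds_iff_ball.1 ho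
  refine ⟨δ / 2, by positivity, fun y hy => ?_⟩
  have hsmall : ∀ c ∈ Set.Icc (0 : ℝ) 1,
      ‖gradient φ (z + c • y) - gradient φ z - hess φ z (c • y)‖ ≤ η / 2 * (c * ‖y‖) := by
    intro c hc
    have hn : ‖c • y‖ = c * ‖y‖ := by rw [norm_smul, Real.norm_of_nonneg hc.1]
    have := hball (c • y) (by
      rw [mem_ball_zero_iff, hn]
      nlinarith [hc.1, hc.2, norm_nonneg y])
    rwa [hn] at this
  set e : ℝ → ℝ := fun r => φ (z + r • y) - r * inner ℝ (gradient φ z) y -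
    r ^ 2 / 2 * inner ℝ (hess φ z y) y with he
  have hde : ∀ r, HasDerivAt e (inner ℝ (gradient φ (z + r • y)) y - inner ℝ (gradient φ z) y -
      r * inner ℝ (hess φ z y) y) r := by
    intro r
    have h1 := hasDerivAt_line hd z y r
    have h2 := (hasDerivAt_id r).mul_const (inner ℝ (gradient φ z) y)
    have h3 := (((hasDerivAt_id r).pow 2).div_const 2).mul_const (inner ℝ (hess φ z y) y)
    refine ((h1.sub h2).sub h3).congr_deriv ?_
    simp
  obtain ⟨c, hc, hce⟩ := exists_hasDerivAt_eq_slope e _ zero_lt_one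
    (fun r _ => (hde r).continuousAt.continuousWithinAt) (fun r _ => hde r)
  have hc' : c ∈ Set.Icc (0 : ℝ) 1 := ⟨hc.1.le, hc.2.le⟩
  have hA : inner ℝ (gradient φ (z + c • y)) y - inner ℝ (gradient φ z) y -
      c * inner ℝ (hess φ z y) y ≤ η / 2 * ‖y‖ ^ 2 := by
    have h1 := real_inner_le_norm (gradient φ (z + c • y) - gradient φ z - hess φ z (c • y)) y
    rw [map_smul] at h1
    simp only [inner_sub_left, inner_smul_left, conj_trivial] at h1
    have h2 := hsmall c hc'
    rw [map_smul] at h2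
    have h3 : ‖gradient φ (z + c • y) - gradient φ z - c • hess φ z y‖ * ‖y‖ ≤
        η / 2 * (1 * ‖y‖) * ‖y‖ := by
      gcongr
      refine h2.trans ?_
      gcongr
      exact hc'.2
    linarith
  have hB : -(η / 2 * ‖y‖ ^ 2) ≤ inner ℝ (gradient φ (z + y)) y - inner ℝ (gradient φ z) y -
      inner ℝ (hess φ z y) y := by
    have h2 := hsmall 1 (by simp)
    rw [one_smul, one_mul] at h2
    have h1 := abs_real_inner_le_norm (gradient φ (z + y) - gradient φ z - hess φ z y) y
    simp only [inner_sub_left] at h1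
    have h3 : ‖gradient φ (z + y) - gradient φ z - hess φ z y‖ * ‖y‖ ≤ η / 2 * ‖y‖ * ‖y‖ := by
      gcongr
    have := neg_le_of_abs_le (h1.trans h3)
    linarith
  simp only [he, one_smul, zero_smul, add_zero] at hce
  unfold bregman
  rw [show z - (z + y) = -y by abel, inner_neg_right]
  linarith

/-- The second-order expansion at a point `z` where the Hessian of `φ` is invertible and `g` is
differentiable, as an upper bound that is uniform over all competitors `x`. -/
theorem eventually_neg_bregman_sub_le (hφ : ContDiff ℝ 2 φ) (hc : ConvexOn ℝ Set.univ φ)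
    {z : EuclideanSpace ℝ (Fin n)} (hinv : (hess φ z).IsInvertible)
    {g : EuclideanSpace ℝ (Fin n) → ℝ} {b : EuclideanSpace ℝ (Fin n)} (hg : HasGradientAt g b z)
    {K : Set (EuclideanSpace ℝ (Fin n))} {M : ℝ} (hM : ∀ x ∈ K, |g x| ≤ M) (hzK : z ∈ K)
    {η : ℝ} (hη : 0 < η) :
    ∀ᶠ t in 𝓝 (0 : ℝ), ∀ x ∈ K, -bregman φ z x - t * (g x - g z) ≤
      t ^ 2 * (1 / 2 * inner ℝ ((hess φ z).inverse b) b + η) := by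
  have hd := hφ.differentiable (by norm_num)
  set H := hess φ z with hH
  have hsymm := hess_symm hφ z
  have hpos := hess_nonneg hφ hc z
  obtain ⟨c, hc0, hcoer⟩ := exists_coercive hsymm hpos hinv
  set Q := 1 / 2 * inner ℝ (H.inverse b) b with hQ
  have hQ0 : 0 ≤ Q := by
    have := neg_quadratic_sub_linear_le hsymm hpos hinv b 0
    simpa only [map_zero, inner_zero_right, mul_zero, neg_zero, sub_zero] using this
  -- Increments `y` with `‖y‖ ≤ ρ * |t|` are handled by the quadratic expansion, all others do not
  -- compete, by coercivity of the Hessian.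
  set ρ := 4 * (‖b‖ + 1) / c with hρ
  have hρ0 : 0 < ρ := by positivity
  obtain ⟨ε, hε0, hε1, hεc, hερ⟩ : ∃ ε > 0, ε ≤ 1 ∧ ε ≤ c / 4 ∧ ε * (ρ ^ 2 + ρ) ≤ η := by
    refine ⟨min 1 (min (c / 4) (η / (ρ ^ 2 + ρ))), by positivity, min_le_left _ _,
      (min_le_right _ _).trans (min_le_left _ _), ?_⟩
    rw [← le_div_iff₀ (by positivity)]
    exact (min_le_right _ _).trans (min_le_right _ _)
  obtain ⟨δ₁, hδ₁, h1⟩ := exists_quadratic_le_bregman hφ z hε0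
  have ho := (hasFDerivAt_iff_isLittleO_nhds_zero.1 hg.hasFDerivAt).def hε0
  obtain ⟨δ₂, hδ₂, h2⟩ := Metric.eventually_nhds_iff_ball.1 ho
  set δ := min δ₁ (δ₂ / 2) with hδ
  have hδ0 : 0 < δ := by positivity
  have hM0 : 0 ≤ M := (abs_nonneg _).trans (hM z hzK)
  refine Metric.eventually_nhds_iff_ball.2 ⟨c * δ ^ 2 / (8 * (M + 1)), by positivity, ?_⟩
  intro t ht x hx
  rw [mem_ball_zero_iff, Real.norm_eq_abs, lt_div_iff₀ (by positivity)] at ht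
  have hrhs : 0 ≤ t ^ 2 * (Q + η) := by positivity
  obtain ⟨y, rfl⟩ : ∃ y, x = z + y := ⟨x - z, by abel⟩
  have hnear : ∀ y : EuclideanSpace ℝ (Fin n), ‖y‖ ≤ δ →
      1 / 2 * inner ℝ (H y) y - ε * ‖y‖ ^ 2 ≤ bregman φ z (z + y) := fun y hy =>
    h1 y (hy.trans (min_le_left _ _))
  rcases le_or_gt ‖y‖ δ with hy | hy
  · have hD := hnear y hy
    have hG : |g (z + y) - g z - inner ℝ b y| ≤ ε * ‖y‖ := by
      have := h2 y (by
        rw [mem_ball_zero_iff]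
        linarith [hy.trans (min_le_right _ _)])
      simpa [InnerProductSpace.toDual_apply_apply] using this
    have htG : -(t * (g (z + y) - g z)) ≤ -(t * inner ℝ b y) + |t| * (ε * ‖y‖) := by
      have h3 : |t * (g (z + y) - g z - inner ℝ b y)| ≤ |t| * (ε * ‖y‖) := by
        rw [abs_mul]; gcongr
      have := neg_le_of_abs_le h3
      linarith
    rcases le_or_gt ‖y‖ (ρ * |t|) with hyt | hyt
    · have hq := neg_quadratic_sub_linear_le hsymm hpos hinv (t • b) y
      rw [map_smul] at hq
      simp only [inner_smul_left, inner_smul_right, conj_trivial] at hq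
      have h4 : ε * ‖y‖ ^ 2 ≤ ε * (ρ * |t|) ^ 2 := by gcongr
      have h5 : |t| * (ε * ‖y‖) ≤ |t| * (ε * (ρ * |t|)) := by gcongr
      have h6 : ε * (ρ * |t|) ^ 2 + |t| * (ε * (ρ * |t|)) = ε * (ρ ^ 2 + ρ) * t ^ 2 := by
        rw [← sq_abs t]; ring
      have h7 : ε * (ρ ^ 2 + ρ) * t ^ 2 ≤ η * t ^ 2 := by gcongr
      have h8 : 1 / 2 * (t * (t * inner ℝ (H.inverse b) b)) = t ^ 2 * Q := by rw [hQ]; ring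
      linarith
    · refine le_trans ?_ hrhs
      have h4 := hcoer y
      have h5 : |t| * (‖b‖ + 1) ≤ c / 4 * ‖y‖ := by
        rw [hρ, div_mul_eq_mul_div, div_lt_iff₀ hc0] at hyt
        linarith
      have h6 : -(t * inner ℝ b y) ≤ |t| * (‖b‖ * ‖y‖) := by
        refine (neg_le_abs _).trans ?_
        rw [abs_mul]
        gcongr
        exact abs_real_inner_le_norm _ _
      have h7 : ε * ‖y‖ ^ 2 ≤ c / 4 * ‖y‖ ^ 2 := by gcongr
      have h8 : |t| * (ε * ‖y‖) ≤ |t| * (1 * ‖y‖) := by gcongr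
      have h9 : |t| * (‖b‖ + 1) * ‖y‖ ≤ c / 4 * ‖y‖ * ‖y‖ := by gcongr
      nlinarith
  · refine le_trans ?_ hrhs
    have hy0 : 0 < ‖y‖ := hδ0.trans hy
    have hn : ‖(δ / ‖y‖) • y‖ = δ := by
      rw [norm_smul, Real.norm_of_nonneg (by positivity), div_mul_cancel₀ _ hy0.ne']
    have hD : c * δ ^ 2 / 4 ≤ bregman φ z (z + y) := by
      refine le_trans ?_ (bregman_ray_mono hd hc z y (r := δ / ‖y‖) (by positivity)
        ((div_le_one hy0).2 hy.le))
      refine le_trans ?_ (hnear _ hn.le)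
      have h4 := hcoer ((δ / ‖y‖) • y)
      rw [hn] at h4 ⊢
      have h7 : ε * δ ^ 2 ≤ c / 4 * δ ^ 2 := by gcongr
      linarith
    have hG : -(t * (g (z + y) - g z)) ≤ |t| * (2 * M) := by
      refine (neg_le_abs _).trans ?_
      rw [abs_mul]
      gcongr
      refine (abs_sub _ _).trans ?_
      linarith [hM _ hx, hM _ hzK]
    nlinarith [abs_nonneg t]

/-- The uniform counterpart of `eventually_neg_bregman_sub_le`: it requires no information on the
inverse Hessian, because `g` varies no faster than the gradient of `φ`. -/
theorem neg_bregman_sub_le {z x : EuclideanSpace ℝ (Fin n)} {g : EuclideanSpace ℝ (Fin n) → ℝ}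
    {L M : ℝ} (hM : 0 < M)
    (h1 : ‖gradient φ z - gradient φ x‖ ^ 2 ≤ M * bregman φ z x)
    (h2 : |g x - g z| ≤ L * ‖gradient φ z - gradient φ x‖) (t : ℝ) :
    -bregman φ z x - t * (g x - g z) ≤ t ^ 2 * (L ^ 2 * M / 4) := by
  set v := ‖gradient φ z - gradient φ x‖ with hv
  have h3 : -(t * (g x - g z)) ≤ |t| * (L * v) := by
    refine (neg_le_abs _).trans ?_
    rw [abs_mul]
    gcongr
  have h4 : v ^ 2 / M ≤ bregman φ z x := by rw [div_le_iff₀ hM]; linarith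
  have h5 : |t| * (L * v) ≤ v ^ 2 / M + t ^ 2 * (L ^ 2 * M / 4) := by
    rw [← sq_abs t]
    have h6 : v ^ 2 / M + |t| ^ 2 * (L ^ 2 * M / 4) - |t| * (L * v) =
        (v - |t| * L * M / 2) ^ 2 / M := by field_simp; ring
    have h7 : 0 ≤ (v - |t| * L * M / 2) ^ 2 / M := by positivity
    linarith
  linarith

end Expansion

/-! ### Suprema of lowered tangent functions -/

section TangentSup

variable {n : ℕ}

/-- The supremum over `x ∈ K` of the tangent functions of `φ` at `x`, lowered by `t * g x`. It is
a supremum of functions that are affine in `(t, z)`, hence jointly convex, whatever `g` is. -/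
noncomputable def tangentSup (φ g : EuclideanSpace ℝ (Fin n) → ℝ)
    (K : Set (EuclideanSpace ℝ (Fin n))) (w : ℝ × EuclideanSpace ℝ (Fin n)) : ℝ :=
  sSup ((fun x => φ x + inner ℝ (gradient φ x) (w.2 - x) - w.1 * g x) '' K)

variable {φ g : EuclideanSpace ℝ (Fin n) → ℝ} {K : Set (EuclideanSpace ℝ (Fin n))}

theorem continuous_tangentSup (hφ : ContDiff ℝ 2 φ) (hg : Continuous g) (hK : IsCompact K) :
    Continuous (tangentSup φ g K) := by
  have h1 := hφ.continuous
  have h2 := (contDiff_gradient hφ).continuous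
  exact hK.continuous_sSup (f := fun (w : ℝ × EuclideanSpace ℝ (Fin n)) x =>
    φ x + inner ℝ (gradient φ x) (w.2 - x) - w.1 * g x) (by fun_prop)

theorem le_tangentSup (hφ : ContDiff ℝ 2 φ) (hg : Continuous g) (hK : IsCompact K)
    (w : ℝ × EuclideanSpace ℝ (Fin n)) {x : EuclideanSpace ℝ (Fin n)} (hx : x ∈ K) :
    φ x + inner ℝ (gradient φ x) (w.2 - x) - w.1 * g x ≤ tangentSup φ g K w := by
  have h1 := hφ.continuous
  have h2 := (contDiff_gradient hφ).continuous
  refine le_csSup (hK.bddAbove_image ?_) ⟨x, hx, rfl⟩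
  exact Continuous.continuousOn (by fun_prop)

theorem tangentSup_convexOn (hφ : ContDiff ℝ 2 φ) (hg : Continuous g) (hK : IsCompact K)
    (hne : K.Nonempty) : ConvexOn ℝ Set.univ (tangentSup φ g K) := by
  refine ⟨convex_univ, fun w _ w' _ a b ha hb hab => ?_⟩
  refine csSup_le (hne.image _) ?_
  rintro _ ⟨x, hx, rfl⟩
  have h1 := mul_le_mul_of_nonneg_left (le_tangentSup hφ hg hK w hx) ha
  have h2 := mul_le_mul_of_nonneg_left (le_tangentSup hφ hg hK w' hx) hb
  simp only [smul_eq_mul]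
  refine le_trans (le_of_eq ?_) (add_le_add h1 h2)
  have e : (a • w + b • w').2 - x = a • (w.2 - x) + b • (w'.2 - x) := by
    have : x = a • x + b • x := by rw [← add_smul, hab, one_smul]
    nth_rewrite 1 [this]
    simp only [Prod.snd_add, Prod.smul_snd]
    module
  have e1 : (a • w + b • w').1 = a * w.1 + b * w'.1 := by simp
  simp only [e, e1, inner_add_right, inner_smul_right]
  linear_combination (-φ x) * hab

theorem le_tangentSup_self (hφ : ContDiff ℝ 2 φ) (hg : Continuous g) (hK : IsCompact K)
    (t : ℝ) {z : EuclideanSpace ℝ (Fin n)} (hz : z ∈ K) :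
    φ z - t * g z ≤ tangentSup φ g K (t, z) := by
  simpa using le_tangentSup hφ hg hK (t, z) hz

theorem tangentSup_le (hne : K.Nonempty) {t c : ℝ} {z : EuclideanSpace ℝ (Fin n)}
    (h : ∀ x ∈ K, -bregman φ z x - t * (g x - g z) ≤ c) :
    tangentSup φ g K (t, z) ≤ φ z - t * g z + c := by
  refine csSup_le (hne.image _) ?_
  rintro _ ⟨x, hx, rfl⟩
  have := h x hx
  unfold bregman at this
  simp only
  linarith

theorem tangentSup_zero (hφ : ContDiff ℝ 2 φ) (hc : ConvexOn ℝ Set.univ φ) (hg : Continuous g)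
    (hK : IsCompact K) {z : EuclideanSpace ℝ (Fin n)} (hz : z ∈ K) :
    tangentSup φ g K (0, z) = φ z := by
  refine le_antisymm ?_ ?_
  · have := tangentSup_le (φ := φ) (g := g) (t := 0) (c := 0) (z := z) ⟨z, hz⟩ (fun x _ => by
      have := bregman_nonneg (hφ.differentiable (by norm_num)) hc z x
      linarith)
    simpa using this
  · simpa using le_tangentSup_self hφ hg hK 0 hz

end TangentSup

/-! ### Second-order calculus of powers -/

section SecondOrder

theorem tendsto_second_order_quotient {f f' : ℝ → ℝ} {f₂ : ℝ}
    (hf : ∀ᶠ t in 𝓝 (0 : ℝ), HasDerivAt f (f' t) t) (hf' : HasDerivAt f' f₂ 0) :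
    Tendsto (fun t => (f t - f 0 - f' 0 * t) / t ^ 2) (𝓝[≠] 0) (𝓝 (f₂ / 2)) := by
  have h0 : HasDerivAt f (f' 0) 0 := hf.self_of_nhds
  refine HasDerivAt.lhopital_zero_nhdsNE (f' := fun t => f' t - f' 0) (g' := fun t => 2 * t)
    ?_ ?_ ?_ ?_ ?_ ?_
  · filter_upwards [hf.filter_mono nhdsWithin_le_nhds] with t ht
    exact ((ht.sub_const (f 0)).sub ((hasDerivAt_id t).const_mul (f' 0))).congr_deriv (by simp)
  · refine Eventually.of_forall fun t => ?_
    exact (hasDerivAt_pow 2 t).congr_deriv (by simp)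
  · filter_upwards [self_mem_nhdsWithin] with t ht
    exact mul_ne_zero two_ne_zero ht
  · have : ContinuousAt (fun t => f t - f 0 - f' 0 * t) 0 := by
      have := h0.continuousAt
      fun_prop
    have := this.tendsto
    simp only [sub_self, mul_zero] at this
    exact this.mono_left nhdsWithin_le_nhds
  · have : Continuous fun t : ℝ => t ^ 2 := by fun_prop
    have := this.tendsto 0
    simp only [ne_eq, OfNat.ofNat_ne_zero, not_false_eq_true, zero_pow] at this
    exact this.mono_left nhdsWithin_le_nhds
  · have := (hasDerivAt_iff_tendsto_slope.1 hf').div_const 2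
    refine this.congr' ?_
    filter_upwards [self_mem_nhdsWithin] with t ht
    have ht : t ≠ 0 := ht
    rw [slope_def_field, sub_zero]
    field_simp

/-- Second-order expansion at `0` of a power of a quadratic polynomial. -/
theorem tendsto_rpow_quadratic {u : ℝ} (hu : 0 < u) (b c p : ℝ) :
    Tendsto (fun t : ℝ => ((u + b * t + c * t ^ 2) ^ p - u ^ p - p * u ^ (p - 1) * b * t) / t ^ 2)
      (𝓝[≠] 0) (𝓝 (p * u ^ (p - 1) * c + p * (p - 1) * u ^ (p - 2) * b ^ 2 / 2)) := by
  set w : ℝ → ℝ := fun t => u + b * t + c * t ^ 2 with hw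
  have hwc : Continuous w := by fun_prop
  have hw0 : w 0 = u := by simp [hw]
  have hdw : ∀ t, HasDerivAt w (b + c * (2 * t)) t := fun t =>
    ((((hasDerivAt_id t).const_mul b).const_add u).add
      ((hasDerivAt_pow 2 t).const_mul c)).congr_deriv (by simp)
  have hpos : ∀ᶠ t in 𝓝 (0 : ℝ), 0 < w t :=
    hwc.continuousAt.eventually_const_lt (by rwa [hw0])
  have h1 : ∀ᶠ t in 𝓝 (0 : ℝ), HasDerivAt (fun t => w t ^ p)
      ((b + c * (2 * t)) * p * w t ^ (p - 1)) t := by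
    filter_upwards [hpos] with t ht
    exact (hdw t).rpow_const (Or.inl ht.ne')
  have h2 : HasDerivAt (fun t => (b + c * (2 * t)) * p * w t ^ (p - 1))
      (c * 2 * p * u ^ (p - 1) + b * p * (b * (p - 1) * u ^ (p - 2))) 0 := by
    have h3 : HasDerivAt (fun t : ℝ => (b + c * (2 * t)) * p) (c * 2 * p) 0 :=
      (((((hasDerivAt_id (0 : ℝ)).const_mul 2).const_mul c).const_add b).mul_const p).congr_deriv
        (by simp)
    have h4 := (hdw 0).rpow_const (p := p - 1) (Or.inl (by rw [hw0]; exact hu.ne'))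
    refine (h3.mul h4).congr_deriv ?_
    rw [hw0, show p - 1 - 1 = p - 2 by ring]
    simp
  have h5 := tendsto_second_order_quotient h1 h2
  simp only [hw0] at h5
  convert h5 using 2
  · simp only [hw]; ring
  · ring

theorem rpow_neg_tangent_le {u v : ℝ} (hu : 0 < u) (hv : 0 < v) {p : ℝ} (hp : 0 < p) :
    u ^ (-p) - p * u ^ (-p - 1) * (v - u) ≤ v ^ (-p) := by
  have h1 : 1 - p * (v / u - 1) ≤ (v / u) ^ (-p) := by
    have hq : 0 < v / u := by positivity
    rw [Real.rpow_def_of_pos hq]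
    have h2 := Real.log_le_sub_one_of_pos hq
    have h3 := Real.add_one_le_exp (Real.log (v / u) * -p)
    nlinarith
  have h4 : v ^ (-p) = (v / u) ^ (-p) * u ^ (-p) := by
    rw [← Real.mul_rpow (by positivity) hu.le, div_mul_cancel₀ _ hu.ne']
  rw [h4, Real.rpow_sub_one hu.ne']
  have h5 : 0 < u ^ (-p) := Real.rpow_pos_of_pos hu _
  have h6 := mul_le_mul_of_nonneg_right h1 h5.le
  refine le_trans (le_of_eq ?_) h6
  field_simp

/-- If `F ^ (-σ)` is midpoint convex at `0` and `F` is bounded below by quadratic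
polynomials along `u` and `-u`, then their second derivative is constrained. -/
theorem second_derivative_le_of_midpoint_convex {F : ℝ → ℝ} {A b q σ : ℝ} (hA : 0 < A)
    (hσ : 0 < σ) {u : ℕ → ℝ} (hu : Tendsto u atTop (𝓝[≠] 0))
    (hmid : ∀ᶠ j in atTop, 2 * A ^ (-σ) ≤ F (u j) ^ (-σ) + F (-u j) ^ (-σ))
    (h1 : ∀ᶠ j in atTop, A + b * u j + q / 2 * u j ^ 2 ≤ F (u j))
    (h2 : ∀ᶠ j in atTop, A - b * u j + q / 2 * u j ^ 2 ≤ F (-u j)) :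
    A * q ≤ (1 + σ) * b ^ 2 := by
  have t1 := (tendsto_rpow_quadratic hA b (q / 2) (-σ)).comp hu
  have t2 := (tendsto_rpow_quadratic hA (-b) (q / 2) (-σ)).comp hu
  have t3 := t1.add t2
  have hu0 : Tendsto u atTop (𝓝 0) := hu.mono_right nhdsWithin_le_nhds
  have hpos : ∀ b : ℝ, ∀ᶠ j in atTop, 0 < A + b * u j + q / 2 * u j ^ 2 := fun b => by
    have hc : Continuous fun t : ℝ => A + b * t + q / 2 * t ^ 2 := by fun_prop
    have := (hc.tendsto 0).comp hu0
    simp only [mul_zero, add_zero, ne_eq, OfNat.ofNat_ne_zero, not_false_eq_true, zero_pow] at this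
    exact this.eventually_const_lt hA
  have h0 := ge_of_tendsto t3 (b := 0) (by
    filter_upwards [hmid, h1, h2, hpos b, hpos (-b)] with j m1 m2 m3 m4 m5
    have k1 : F (u j) ^ (-σ) ≤ (A + b * u j + q / 2 * u j ^ 2) ^ (-σ) :=
      Real.rpow_le_rpow_of_nonpos m4 m2 (by linarith)
    have k2 : F (-u j) ^ (-σ) ≤ (A + -b * u j + q / 2 * u j ^ 2) ^ (-σ) :=
      Real.rpow_le_rpow_of_nonpos m5 (by linarith) (by linarith)
    simp only [Function.comp]
    rw [← add_div]
    refine div_nonneg ?_ (sq_nonneg _)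
    linarith)
  have e1 : A ^ (-σ - 1) = A ^ (-σ - 2) * A := by
    rw [← Real.rpow_add_one hA.ne']; congr 1; ring
  have hAp : 0 < A ^ (-σ - 2) := Real.rpow_pos_of_pos hA _
  rw [e1] at h0
  have e2 : -σ * (A ^ (-σ - 2) * A) * (q / 2) + -σ * (-σ - 1) * A ^ (-σ - 2) * b ^ 2 / 2 +
      (-σ * (A ^ (-σ - 2) * A) * (q / 2) + -σ * (-σ - 1) * A ^ (-σ - 2) * (-b) ^ 2 / 2) =
      (σ * A ^ (-σ - 2)) * ((1 + σ) * b ^ 2 - A * q) := by ring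
  rw [e2] at h0
  have := (mul_nonneg_iff_of_pos_left (by positivity)).1 h0
  linarith

end SecondOrder

/-! ### Convexity of the integral functional on a compact convex set -/

section Ball

variable {n : ℕ} {φ g : EuclideanSpace ℝ (Fin n) → ℝ} {K : Set (EuclideanSpace ℝ (Fin n))}

/-- The functional `t ↦ (∫ Φ_t ^ (-β)) ^ (-1 / (β - n))` over a compact convex set, with `Φ_t` the
supremum of the lowered tangent functions, is convex. -/
theorem convexENN_lintegral_tangentSup {β : ℝ} (hβ : n < β) (hφ : ContDiff ℝ 2 φ)
    (hg : Continuous g) (hK : IsCompact K) (hKc : Convex ℝ K) (hne : K.Nonempty) :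
    ConvexENN fun t : ℝ => (∫⁻ z in K, ENNReal.ofReal (tangentSup φ g K (t, z)) ^ (-β)) ^
      (-(1 / (β - n))) := by
  classical
  have hβ0 : 0 < β := lt_of_le_of_lt n.cast_nonneg hβ
  set Φ : ℝ × EuclideanSpace ℝ (Fin n) → ℝ≥0∞ := fun w =>
    if w.2 ∈ K then ENNReal.ofReal (tangentSup φ g K w) else ∞ with hΦ
  have hconv : ConvexENN Φ := by
    intro w w' a b ha hb hab
    have ha' : ENNReal.ofReal a ≠ 0 := by simpa using ha
    have hb' : ENNReal.ofReal b ≠ 0 := by simpa using hb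
    by_cases h1 : w.2 ∈ K
    swap
    · simp only [hΦ, if_neg h1, ENNReal.mul_top ha', top_add]; exact le_top
    by_cases h2 : w'.2 ∈ K
    swap
    · simp only [hΦ, if_neg h2, ENNReal.mul_top hb', add_top]; exact le_top
    have h3 : (a • w + b • w').2 ∈ K := hKc h1 h2 ha.le hb.le hab
    simp only [hΦ, if_pos h1, if_pos h2, if_pos h3]
    rw [← ENNReal.ofReal_mul ha.le, ← ENNReal.ofReal_mul hb.le]
    refine le_trans (ENNReal.ofReal_le_ofReal ?_) ENNReal.ofReal_add_le
    exact (tangentSup_convexOn hφ hg hK hne).2 (Set.mem_univ w) (Set.mem_univ w') ha.le hb.le hab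
  have hmeas : Measurable Φ :=
    Measurable.ite (measurable_snd hK.measurableSet)
      (continuous_tangentSup hφ hg hK).measurable.ennreal_ofReal measurable_const
  convert hconv.marginal_euclideanSpace hβ hmeas using 3 with t
  rw [← lintegral_indicator hK.measurableSet]
  refine lintegral_congr fun z => ?_
  by_cases hz : z ∈ K
  · simp [hΦ, hz]
  · simp [hΦ, hz, ENNReal.top_rpow_of_neg (neg_lt_zero.2 hβ0)]

end Ball

/-! ### Pointwise bounds for the second-order remainder -/

section Remainder

variable {n : ℕ}

/-- The density `⟨(Hess φ)⁻¹ ∇g, ∇g⟩`. -/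
noncomputable def hessEnergy (φ g : EuclideanSpace ℝ (Fin n) → ℝ)
    (z : EuclideanSpace ℝ (Fin n)) : ℝ :=
  inner ℝ ((hess φ z).inverse (gradient g z)) (gradient g z)

/-- The second-order difference quotient in `t` at `0` of `Φ_t ^ (-β)`, where `Φ_t` is the
supremum of the lowered tangent functions. -/
noncomputable def rpowRemainder (φ g : EuclideanSpace ℝ (Fin n) → ℝ)
    (K : Set (EuclideanSpace ℝ (Fin n))) (β t : ℝ) (z : EuclideanSpace ℝ (Fin n)) : ℝ :=
  (tangentSup φ g K (t, z) ^ (-β) - φ z ^ (-β) - β * t * (g z * φ z ^ (-β - 1))) / t ^ 2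

variable {φ g : EuclideanSpace ℝ (Fin n) → ℝ} {K : Set (EuclideanSpace ℝ (Fin n))}

theorem eventually_tangentSup_pos (hφ : ContDiff ℝ 2 φ) (hg : Continuous g) (hK : IsCompact K)
    {ε : ℝ} (hε : 0 < ε) (hlow : ∀ z, ε ≤ φ z) :
    ∀ᶠ t in 𝓝 (0 : ℝ), ∀ z ∈ K, 0 < tangentSup φ g K (t, z) := by
  obtain ⟨M, hM⟩ := hK.exists_bound_of_continuousOn hg.continuousOn
  refine Metric.eventually_nhds_iff_ball.2 ⟨ε / (|M| + 1), by positivity, fun t ht z hz => ?_⟩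
  rw [mem_ball_zero_iff, Real.norm_eq_abs, lt_div_iff₀ (by positivity)] at ht
  refine lt_of_lt_of_le ?_ (le_tangentSup_self hφ hg hK t hz)
  have h1 : t * g z ≤ |t| * (|M| + 1) := by
    refine (le_abs_self _).trans ?_
    rw [abs_mul]
    gcongr
    have := hM z hz
    rw [Real.norm_eq_abs] at this
    linarith [le_abs_self M]
  linarith [hlow z]

/-- The lower bound for the remainder that makes Fatou's lemma applicable. -/
theorem le_rpowRemainder {β t N : ℝ} (hβ : 0 < β) (ht : t ≠ 0) {z : EuclideanSpace ℝ (Fin n)}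
    (hz : 0 < φ z) (hP : 0 < tangentSup φ g K (t, z))
    (hN : tangentSup φ g K (t, z) ≤ φ z - t * g z + t ^ 2 * N) :
    -(β * φ z ^ (-β - 1) * N) ≤ rpowRemainder φ g K β t z := by
  have ht2 : 0 < t ^ 2 := by positivity
  have h1 := rpow_neg_tangent_le hz hP hβ
  have hp : 0 < φ z ^ (-β - 1) := Real.rpow_pos_of_pos hz _
  unfold rpowRemainder
  rw [le_div_iff₀ ht2]
  have h2 : β * φ z ^ (-β - 1) * (tangentSup φ g K (t, z) - φ z) ≤
      β * φ z ^ (-β - 1) * (-(t * g z) + t ^ 2 * N) := by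
    gcongr
    linarith
  linarith

/-- The pointwise asymptotic lower bound for the remainder at good points `z`. -/
theorem eventually_le_rpowRemainder (hφ : ContDiff ℝ 2 φ) (hc : ConvexOn ℝ Set.univ φ)
    (hg : Continuous g) (hK : IsCompact K) {ε : ℝ} (hε : 0 < ε) (hlow : ∀ z, ε ≤ φ z)
    {β : ℝ} (hβ : 0 < β) {z : EuclideanSpace ℝ (Fin n)} (hz : z ∈ K)
    (hinv : (hess φ z).IsInvertible) (hgd : DifferentiableAt ℝ g z) {η : ℝ} (hη : 0 < η) :
    ∀ᶠ t in 𝓝[≠] (0 : ℝ), β * (β + 1) / 2 * (g z ^ 2 * φ z ^ (-β - 2)) -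
      β / 2 * (hessEnergy φ g z * φ z ^ (-β - 1)) - η ≤ rpowRemainder φ g K β t z := by
  have hu : 0 < φ z := hε.trans_le (hlow z)
  have hp : 0 < φ z ^ (-β - 1) := Real.rpow_pos_of_pos hu _
  set p := φ z ^ (-β - 1) with hpdef
  set η' := η / (2 * (β * p)) with hη'
  have hη'0 : 0 < η' := by positivity
  have hη'e : β * p * η' = η / 2 := by rw [hη']; field_simp
  obtain ⟨M, hM⟩ := hK.exists_bound_of_continuousOn hg.continuousOn
  have h1 := eventually_neg_bregman_sub_le hφ hc hinv hgd.hasGradientAt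
    (fun x hx => hM x hx) hz hη'0
  set c := 1 / 2 * inner ℝ ((hess φ z).inverse (gradient g z)) (gradient g z) + η' with hcdef
  have h2 := tendsto_rpow_quadratic hu (-g z) c (-β)
  have h3 := h2.eventually_const_lt (sub_lt_self _ (half_pos hη))
  filter_upwards [h1.filter_mono nhdsWithin_le_nhds, h3, self_mem_nhdsWithin,
    (eventually_tangentSup_pos hφ hg hK hε hlow).filter_mono nhdsWithin_le_nhds]
    with t k1 k2 k3 k4
  have k3 : t ≠ 0 := k3
  have h4 := tangentSup_le ⟨z, hz⟩ k1
  have h5 : (φ z + -g z * t + c * t ^ 2) ^ (-β) ≤ tangentSup φ g K (t, z) ^ (-β) :=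
    Real.rpow_le_rpow_of_nonpos (k4 z hz) (by linarith) (by linarith)
  have h6 : ((φ z + -g z * t + c * t ^ 2) ^ (-β) - φ z ^ (-β) - -β * p * -g z * t) / t ^ 2 ≤
      rpowRemainder φ g K β t z := by
    unfold rpowRemainder
    gcongr ?_ / _
    rw [← hpdef]
    linarith
  refine le_trans ?_ (k2.le.trans h6)
  unfold hessEnergy
  rw [hcdef]
  refine le_of_eq ?_
  linear_combination hη'e

end Remainder

/-! ### The inequality on a compact convex set -/

section Fatou

variable {n : ℕ} {φ g : EuclideanSpace ℝ (Fin n) → ℝ} {K : Set (EuclideanSpace ℝ (Fin n))}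

theorem integrableOn_mul_rpow (hφ : Continuous φ) (hK : IsCompact K) (hpos : ∀ z, 0 < φ z)
    {h : EuclideanSpace ℝ (Fin n) → ℝ} (hh : Continuous h) (p : ℝ) :
    IntegrableOn (fun z => h z * φ z ^ p) K := by
  refine ContinuousOn.integrableOn_compact hK ?_
  exact hh.continuousOn.mul (hφ.continuousOn.rpow_const fun z _ => Or.inl (hpos z).ne')

theorem integrableOn_rpow (hφ : Continuous φ) (hK : IsCompact K) (hpos : ∀ z, 0 < φ z) (p : ℝ) :
    IntegrableOn (fun z => φ z ^ p) K := by
  simpa using integrableOn_mul_rpow hφ hK hpos (h := fun _ => 1) continuous_const p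

theorem integrableOn_tangentSup_rpow (hφ : ContDiff ℝ 2 φ) (hg : Continuous g) (hK : IsCompact K)
    {t : ℝ} (ht : ∀ z ∈ K, 0 < tangentSup φ g K (t, z)) (p : ℝ) :
    IntegrableOn (fun z => tangentSup φ g K (t, z) ^ p) K := by
  refine ContinuousOn.integrableOn_compact hK ?_
  have : Continuous fun z => tangentSup φ g K (t, z) :=
    (continuous_tangentSup hφ hg hK).comp (by fun_prop)
  exact this.continuousOn.rpow_const fun z hz => Or.inl (ht z hz).ne'

/-- Fatou's lemma for the second-order remainder, which is bounded below by the constant `-c`. -/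
theorem ofReal_integral_le_liminf_rpowRemainder (hφ : ContDiff ℝ 2 φ) (hc : ConvexOn ℝ Set.univ φ)
    (hg : Continuous g) (hK : IsCompact K) {ε : ℝ} (hε : 0 < ε) (hlow : ∀ z, ε ≤ φ z)
    {β : ℝ} (hβ : 0 < β)
    (hgood : ∀ᵐ z ∂volume.restrict K, (hess φ z).IsInvertible ∧ DifferentiableAt ℝ g z)
    {u : ℕ → ℝ} (hu : Tendsto u atTop (𝓝[≠] 0)) {c : ℝ} (hc0 : 0 ≤ c) :
    ENNReal.ofReal (β * (β + 1) / 2 * (∫ z in K, g z ^ 2 * φ z ^ (-β - 2)) +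
        c * volume.real K) ≤
      liminf (fun j => ∫⁻ z in K, ENNReal.ofReal (rpowRemainder φ g K β (u j) z + c)) atTop +
        ENNReal.ofReal (β / 2) *
          ∫⁻ z in K, ENNReal.ofReal (hessEnergy φ g z * φ z ^ (-β - 1)) := by
  have hpos : ∀ z, 0 < φ z := fun z => hε.trans_le (hlow z)
  have hφm : Measurable φ := hφ.continuous.measurable
  have hgm : Measurable g := hg.measurable
  have hmeas : ∀ j, Measurable fun z => ENNReal.ofReal (rpowRemainder φ g K β (u j) z + c) := by
    intro j
    have : Continuous fun z => tangentSup φ g K (u j, z) :=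
      (continuous_tangentSup hφ hg hK).comp (by fun_prop)
    have := this.measurable
    unfold rpowRemainder
    fun_prop
  have hint : IntegrableOn (fun z => g z ^ 2 * φ z ^ (-β - 2)) K :=
    integrableOn_mul_rpow hφ.continuous hK hpos (by fun_prop) _
  have hintc : IntegrableOn (fun _ : EuclideanSpace ℝ (Fin n) => c) K :=
    continuousOn_const.integrableOn_compact hK
  have e1 : β * (β + 1) / 2 * (∫ z in K, g z ^ 2 * φ z ^ (-β - 2)) + c * volume.real K =
      ∫ z in K, (β * (β + 1) / 2 * (g z ^ 2 * φ z ^ (-β - 2)) + c) := by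
    rw [integral_add (hint.const_mul _) hintc, integral_const_mul, setIntegral_const, smul_eq_mul,
      mul_comm c]
  have hints : IntegrableOn (fun z => β * (β + 1) / 2 * (g z ^ 2 * φ z ^ (-β - 2)) + c) K :=
    (hint.const_mul _).add hintc
  rw [e1, ofReal_integral_eq_lintegral_ofReal hints
    (Eventually.of_forall fun z => by
      have := Real.rpow_nonneg (hpos z).le (-β - 2)
      simp only [Pi.zero_apply]
      positivity)]
  calc ∫⁻ z in K, ENNReal.ofReal (β * (β + 1) / 2 * (g z ^ 2 * φ z ^ (-β - 2)) + c)
      ≤ ∫⁻ z in K, (liminf (fun j => ENNReal.ofReal (rpowRemainder φ g K β (u j) z + c)) atTop +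
          ENNReal.ofReal (β / 2) * ENNReal.ofReal (hessEnergy φ g z * φ z ^ (-β - 1))) := by
        refine lintegral_mono_ae ?_
        filter_upwards [hgood, ae_restrict_mem hK.measurableSet] with z ⟨hz1, hz2⟩ hzK
        refine ENNReal.le_of_forall_pos_le_add fun η hη _ => ?_
        have hη' : (0 : ℝ) < η := by exact_mod_cast hη
        set X := β * (β + 1) / 2 * (g z ^ 2 * φ z ^ (-β - 2))
        set W := hessEnergy φ g z * φ z ^ (-β - 1)
        have h1 := hu.eventually
          (eventually_le_rpowRemainder hφ hc hg hK hε hlow hβ hzK hz1 hz2 hη')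
        have h2 : ENNReal.ofReal (X - β / 2 * W - η + c) ≤
            liminf (fun j => ENNReal.ofReal (rpowRemainder φ g K β (u j) z + c)) atTop := by
          refine le_liminf_of_le (by isBoundedDefault) ?_
          filter_upwards [h1] with j hj
          exact ENNReal.ofReal_le_ofReal (add_le_add hj le_rfl)
        calc ENNReal.ofReal (X + c)
            = ENNReal.ofReal (X - β / 2 * W - η + c + β / 2 * W + η) := by congr 1; ring
          _ ≤ ENNReal.ofReal (X - β / 2 * W - η + c) + ENNReal.ofReal (β / 2 * W) +
              ENNReal.ofReal η := by
            refine ENNReal.ofReal_add_le.trans ?_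
            gcongr
            exact ENNReal.ofReal_add_le
          _ ≤ _ := by
            rw [ENNReal.ofReal_mul (by positivity), ENNReal.ofReal_coe_nnreal]
            gcongr
    _ = (∫⁻ z in K, liminf (fun j => ENNReal.ofReal (rpowRemainder φ g K β (u j) z + c)) atTop) +
          ENNReal.ofReal (β / 2) *
            ∫⁻ z in K, ENNReal.ofReal (hessEnergy φ g z * φ z ^ (-β - 1)) := by
        rw [lintegral_add_left (Measurable.liminf hmeas),
          lintegral_const_mul' _ _ ENNReal.ofReal_ne_top]
    _ ≤ _ := by
        gcongr
        exact lintegral_liminf_le hmeas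

/-- The quadratic lower bound for the integral of `Φ_t ^ (-β)`. -/
theorem eventually_quadratic_le_integral (hφ : ContDiff ℝ 2 φ) (hc : ConvexOn ℝ Set.univ φ)
    (hg : Continuous g) (hK : IsCompact K) {ε : ℝ} (hε : 0 < ε) (hlow : ∀ z, ε ≤ φ z)
    {β : ℝ} (hβ : 0 < β)
    (hgood : ∀ᵐ z ∂volume.restrict K, (hess φ z).IsInvertible ∧ DifferentiableAt ℝ g z)
    {N : ℝ} (hN0 : 0 ≤ N)
    (hN : ∀ t, ∀ z ∈ K, ∀ x ∈ K, -bregman φ z x - t * (g x - g z) ≤ t ^ 2 * N)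
    {u : ℕ → ℝ} (hu : Tendsto u atTop (𝓝[≠] 0))
    (hD : ∫⁻ z in K, ENNReal.ofReal (hessEnergy φ g z * φ z ^ (-β - 1)) ≠ ∞) {q : ℝ} (hq0 : 0 ≤ q)
    (hq : q < β * (β + 1) * (∫ z in K, g z ^ 2 * φ z ^ (-β - 2)) -
      β * (∫⁻ z in K, ENNReal.ofReal (hessEnergy φ g z * φ z ^ (-β - 1))).toReal) :
    ∀ᶠ j in atTop, (∫ z in K, φ z ^ (-β)) + β * (∫ z in K, g z * φ z ^ (-β - 1)) * u j +
      q / 2 * u j ^ 2 ≤ ∫ z in K, tangentSup φ g K (u j, z) ^ (-β) := by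
  have hpos : ∀ z, 0 < φ z := fun z => hε.trans_le (hlow z)
  set c := β * ε ^ (-β - 1) * N with hcdef
  have hc0 : 0 ≤ c := by positivity
  have hF := ofReal_integral_le_liminf_rpowRemainder hφ hc hg hK hε hlow hβ hgood hu hc0
  set D := ∫⁻ z in K, ENNReal.ofReal (hessEnergy φ g z * φ z ^ (-β - 1)) with hDdef
  set C := ∫ z in K, g z ^ 2 * φ z ^ (-β - 2) with hCdef
  have hlt : ENNReal.ofReal (q / 2 + c * volume.real K) <
      liminf (fun j => ∫⁻ z in K, ENNReal.ofReal (rpowRemainder φ g K β (u j) z + c)) atTop := by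
    by_contra! hle
    have h1 : ENNReal.ofReal (β * (β + 1) / 2 * C + c * volume.real K) ≤
        ENNReal.ofReal (q / 2 + c * volume.real K) + ENNReal.ofReal (β / 2 * D.toReal) := by
      rw [ENNReal.ofReal_mul (by positivity), ENNReal.ofReal_toReal hD]
      exact hF.trans (by gcongr)
    rw [← ENNReal.ofReal_add (by positivity) (by positivity),
      ENNReal.ofReal_le_ofReal_iff (by positivity)] at h1
    linarith
  have hu0 : ∀ᶠ j in atTop, u j ≠ 0 := hu.eventually self_mem_nhdsWithin
  filter_upwards [eventually_lt_of_lt_liminf hlt, hu0,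
    (hu.mono_right nhdsWithin_le_nhds).eventually (eventually_tangentSup_pos hφ hg hK hε hlow)]
    with j h1 h2 h3
  have hi1 := integrableOn_tangentSup_rpow hφ hg hK h3 (-β)
  have hi2 := integrableOn_rpow hφ.continuous hK hpos (-β)
  have hi3 := integrableOn_mul_rpow hφ.continuous hK hpos hg (-β - 1)
  have hintc : IntegrableOn (fun _ : EuclideanSpace ℝ (Fin n) => c) K :=
    continuousOn_const.integrableOn_compact hK
  have hi12 : IntegrableOn (fun z => tangentSup φ g K (u j, z) ^ (-β) - φ z ^ (-β)) K :=
    hi1.sub hi2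
  have hi4 : IntegrableOn (rpowRemainder φ g K β (u j)) K :=
    ((hi1.sub hi2).sub (hi3.const_mul _)).div_const _
  have hY : ∫ z in K, rpowRemainder φ g K β (u j) z =
      ((∫ z in K, tangentSup φ g K (u j, z) ^ (-β)) - (∫ z in K, φ z ^ (-β)) -
        β * u j * ∫ z in K, g z * φ z ^ (-β - 1)) / u j ^ 2 := by
    unfold rpowRemainder
    rw [integral_div, integral_sub hi12 (hi3.const_mul _), integral_sub hi1 hi2,
      integral_const_mul]
  have hYpos : ∀ z ∈ K, 0 ≤ rpowRemainder φ g K β (u j) z + c := by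
    intro z hz
    have k1 := le_rpowRemainder hβ h2 (hpos z) (h3 z hz) (tangentSup_le ⟨z, hz⟩ (hN (u j) z hz))
    have k2 : φ z ^ (-β - 1) ≤ ε ^ (-β - 1) :=
      Real.rpow_le_rpow_of_nonpos hε (hlow z) (by linarith)
    have k3 : β * φ z ^ (-β - 1) * N ≤ c := by rw [hcdef]; gcongr
    linarith
  have hi5 : IntegrableOn (fun z => rpowRemainder φ g K β (u j) z + c) K := hi4.add hintc
  rw [← ofReal_integral_eq_lintegral_ofReal hi5
    ((ae_restrict_mem hK.measurableSet).mono fun z hz => hYpos z hz),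
    integral_add hi4 hintc, hY, setIntegral_const, smul_eq_mul] at h1
  have h4 := (ENNReal.ofReal_lt_ofReal_iff_of_nonneg (by positivity)).1 h1
  have h5 : 0 < u j ^ 2 := by positivity
  have h6 : q / 2 < ((∫ z in K, tangentSup φ g K (u j, z) ^ (-β)) - (∫ z in K, φ z ^ (-β)) -
      β * u j * ∫ z in K, g z * φ z ^ (-β - 1)) / u j ^ 2 := by linarith
  rw [lt_div_iff₀ h5] at h6
  linarith

/-- The dimensional Brascamp–Lieb inequality on a compact convex set, for `φ` bounded away from
zero, in terms of unnormalized integrals. -/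
theorem brascamp_lieb_compact_real {β : ℝ} (hβ : n < β) (hφ : ContDiff ℝ 2 φ)
    (hc : ConvexOn ℝ Set.univ φ)
    (hg : Continuous g) (hK : IsCompact K) (hKc : Convex ℝ K) (hvol : volume K ≠ 0)
    {ε : ℝ} (hε : 0 < ε) (hlow : ∀ z, ε ≤ φ z)
    (hgood : ∀ᵐ z ∂volume.restrict K, (hess φ z).IsInvertible ∧ DifferentiableAt ℝ g z)
    {N : ℝ} (hN0 : 0 ≤ N)
    (hN : ∀ t, ∀ z ∈ K, ∀ x ∈ K, -bregman φ z x - t * (g x - g z) ≤ t ^ 2 * N)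
    (hD : ∫⁻ z in K, ENNReal.ofReal (hessEnergy φ g z * φ z ^ (-β - 1)) ≠ ∞) :
    (∫ z in K, φ z ^ (-β)) * ((β + 1) * (∫ z in K, g z ^ 2 * φ z ^ (-β - 2)) -
      (∫⁻ z in K, ENNReal.ofReal (hessEnergy φ g z * φ z ^ (-β - 1))).toReal) ≤
    (1 + 1 / (β - n)) * β * (∫ z in K, g z * φ z ^ (-β - 1)) ^ 2 := by
  have hβ0 : 0 < β := lt_of_le_of_lt n.cast_nonneg hβ
  have hne : K.Nonempty := nonempty_of_measure_ne_zero hvol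
  have hpos : ∀ z, 0 < φ z := fun z => hε.trans_le (hlow z)
  set σ := 1 / (β - n) with hσ
  have hσ0 : 0 < σ := by have := sub_pos.2 hβ; positivity
  set A := ∫ z in K, φ z ^ (-β) with hA
  set B := ∫ z in K, g z * φ z ^ (-β - 1) with hB
  set C := ∫ z in K, g z ^ 2 * φ z ^ (-β - 2) with hC
  set d := (∫⁻ z in K, ENNReal.ofReal (hessEnergy φ g z * φ z ^ (-β - 1))).toReal with hd
  set F : ℝ → ℝ := fun t => ∫ z in K, tangentSup φ g K (t, z) ^ (-β) with hF
  have hintpos : ∀ w : EuclideanSpace ℝ (Fin n) → ℝ, IntegrableOn w K → (∀ z ∈ K, 0 < w z) →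
      0 < ∫ z in K, w z := by
    intro w hw hwp
    rw [setIntegral_pos_iff_support_of_nonneg_ae
      ((ae_restrict_mem hK.measurableSet).mono fun z hz => (hwp z hz).le) hw]
    refine lt_of_lt_of_le (pos_iff_ne_zero.2 hvol) (measure_mono fun z hz => ⟨?_, hz⟩)
    exact (hwp z hz).ne'
  have hA0 : 0 < A := hintpos _ (integrableOn_rpow hφ.continuous hK hpos (-β))
    fun z _ => Real.rpow_pos_of_pos (hpos z) _
  have hPpos := eventually_tangentSup_pos hφ hg hK hε hlow
  have hFpos : ∀ {t : ℝ}, (∀ z ∈ K, 0 < tangentSup φ g K (t, z)) → 0 < F t := fun ht =>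
    hintpos _ (integrableOn_tangentSup_rpow hφ hg hK ht (-β))
      fun z hz => Real.rpow_pos_of_pos (ht z hz) _
  have hFe : ∀ {t : ℝ}, (∀ z ∈ K, 0 < tangentSup φ g K (t, z)) →
      (∫⁻ z in K, ENNReal.ofReal (tangentSup φ g K (t, z)) ^ (-β)) ^ (-σ) =
        ENNReal.ofReal (F t ^ (-σ)) := by
    intro t ht
    rw [← ENNReal.ofReal_rpow_of_pos (hFpos ht), hF, ofReal_integral_eq_lintegral_ofReal
      (integrableOn_tangentSup_rpow hφ hg hK ht (-β))
      ((ae_restrict_mem hK.measurableSet).mono fun z hz => Real.rpow_nonneg (ht z hz).le _)]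
    congr 1
    refine setLIntegral_congr_fun hK.measurableSet fun z hz => ?_
    exact ENNReal.ofReal_rpow_of_pos (ht z hz)
  have hF0 : F 0 = A :=
    setIntegral_congr_fun hK.measurableSet fun z hz => by
      simp only [tangentSup_zero hφ hc hg hK hz]
  have hmid : ∀ᶠ t in 𝓝 (0 : ℝ), 2 * A ^ (-σ) ≤ F t ^ (-σ) + F (-t) ^ (-σ) := by
    have hneg : Tendsto (fun t : ℝ => -t) (𝓝 0) (𝓝 0) := by
      simpa using (continuous_neg (G := ℝ)).tendsto 0
    filter_upwards [hPpos, hneg.eventually hPpos] with t h1 h2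
    have h3 := convexENN_lintegral_tangentSup hβ hφ hg hK hKc hne t (-t) (1 / 2) (1 / 2)
      (by norm_num) (by norm_num) (by norm_num)
    simp only [← hσ] at h3
    rw [show (1 / 2 : ℝ) • t + (1 / 2 : ℝ) • -t = 0 by simp, hFe hPpos.self_of_nhds, hFe h1,
      hFe h2, hF0, ← ENNReal.ofReal_mul (by norm_num), ← ENNReal.ofReal_mul (by norm_num),
      ← ENNReal.ofReal_add, ENNReal.ofReal_le_ofReal_iff] at h3
    · linarith
    all_goals
      have := Real.rpow_nonneg (hFpos h1).le (-σ)
      have := Real.rpow_nonneg (hFpos h2).le (-σ)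
      positivity
  obtain ⟨u, hu⟩ : ∃ u : ℕ → ℝ, Tendsto u atTop (𝓝[≠] 0) := exists_seq_tendsto _
  have hu' : Tendsto (fun j => -u j) atTop (𝓝[≠] 0) := by
    refine tendsto_nhdsWithin_iff.2 ⟨?_, ?_⟩
    · simpa using (hu.mono_right nhdsWithin_le_nhds).neg
    · filter_upwards [hu.eventually self_mem_nhdsWithin] with j hj
      exact neg_ne_zero.2 hj
  -- A quadratic lower bound is available for each coefficient `q` below the limiting one.
  have hall : ∀ q < β * (β + 1) * C - β * d, A * q ≤ (1 + σ) * (β * B) ^ 2 := by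
    intro q hq
    rcases le_or_gt 0 q with hq0 | hq0
    · have h1 := eventually_quadratic_le_integral hφ hc hg hK hε hlow hβ0 hgood hN0 hN hu hD hq0 hq
      have h2 := eventually_quadratic_le_integral hφ hc hg hK hε hlow hβ0 hgood hN0 hN hu' hD hq0 hq
      refine second_derivative_le_of_midpoint_convex (F := F) hA0 hσ0 hu
        ((hu.mono_right nhdsWithin_le_nhds).eventually hmid) h1 ?_
      filter_upwards [h2] with j hj
      refine le_trans (le_of_eq ?_) hj
      ring
    · have : A * q ≤ 0 := mul_nonpos_of_nonneg_of_nonpos hA0.le hq0.le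
      exact this.trans (by positivity)
  have hfin : A * (β * (β + 1) * C - β * d) ≤ (1 + σ) * (β * B) ^ 2 := by
    rw [← le_div_iff₀' hA0]
    refine le_of_forall_lt_imp_le_of_dense fun q hq => ?_
    rw [le_div_iff₀' hA0]
    exact hall q hq
  have h7 : β * (A * ((β + 1) * C - d)) ≤ β * ((1 + σ) * β * B ^ 2) := by
    linarith
  exact le_of_mul_le_mul_left h7 hβ0

end Fatou

/-! ### Passage to the whole space -/

section Approximation

variable {n : ℕ} {V φ : EuclideanSpace ℝ (Fin n) → ℝ}

theorem gradient_add_const (φ : EuclideanSpace ℝ (Fin n) → ℝ) (c : ℝ) :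
    gradient (fun x => φ x + c) = gradient φ := by
  ext1 x
  simp only [gradient, fderiv_add_const]

theorem locallyLipschitz_comp_gradient (hV : ConvexOn ℝ Set.univ V) (hφ : ContDiff ℝ 2 φ) :
    LocallyLipschitz fun z => V (gradient φ z) :=
  hV.locallyLipschitz.comp (contDiff_gradient hφ).locallyLipschitz

theorem ae_differentiableAt_comp_gradient (hV : ConvexOn ℝ Set.univ V) (hφ : ContDiff ℝ 2 φ) :
    ∀ᵐ z : EuclideanSpace ℝ (Fin n), DifferentiableAt ℝ (fun z => V (gradient φ z)) z := by
  have h : ∀ k : ℕ, ∀ᵐ z : EuclideanSpace ℝ (Fin n), z ∈ Metric.closedBall 0 (k : ℝ) →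
      DifferentiableWithinAt ℝ (fun z => V (gradient φ z)) (Metric.closedBall 0 (k : ℝ)) z := by
    intro k
    obtain ⟨C, hC⟩ := ((locallyLipschitz_comp_gradient hV hφ).locallyLipschitzOn
      (s := Metric.closedBall 0 (k : ℝ))).exists_lipschitzOnWith_of_compact
      (isCompact_closedBall (0 : EuclideanSpace ℝ (Fin n)) (k : ℝ))
    exact hC.ae_differentiableWithinAt_of_mem
  filter_upwards [ae_all_iff.2 h] with z hz
  obtain ⟨k, hk⟩ := exists_nat_gt ‖z‖
  have hz' : z ∈ Metric.ball (0 : EuclideanSpace ℝ (Fin n)) (k : ℝ) := by simpa using hk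
  exact (hz k (Metric.ball_subset_closedBall hz')).differentiableAt
    (mem_of_superset (Metric.isOpen_ball.mem_nhds hz') Metric.ball_subset_closedBall)

/-- The second-order term of the supremum of tangent functions is uniformly bounded on balls. -/
theorem exists_neg_bregman_sub_le (hV : ConvexOn ℝ Set.univ V) (hφ : ContDiff ℝ 2 φ)
    (hc : ConvexOn ℝ Set.univ φ) (R : ℝ) :
    ∃ N ≥ 0, ∀ t, ∀ z ∈ Metric.closedBall (0 : EuclideanSpace ℝ (Fin n)) R,
      ∀ x ∈ Metric.closedBall (0 : EuclideanSpace ℝ (Fin n)) R,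
      -bregman φ z x - t * (V (gradient φ x) - V (gradient φ z)) ≤ t ^ 2 * N := by
  obtain ⟨M, hM0, hM⟩ := exists_norm_gradient_sub_sq_le_bregman hφ hc R
  have hcomp : IsCompact (gradient φ '' Metric.closedBall (0 : EuclideanSpace ℝ (Fin n)) R) :=
    (isCompact_closedBall _ _).image (contDiff_gradient hφ).continuous
  obtain ⟨L, hL⟩ := (hV.locallyLipschitz.locallyLipschitzOn
    (s := gradient φ '' Metric.closedBall 0 R)).exists_lipschitzOnWith_of_compact hcomp
  refine ⟨L ^ 2 * M / 4, by positivity, fun t z hz x hx => ?_⟩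
  refine neg_bregman_sub_le (g := fun z => V (gradient φ z)) hM0 (hM z hz x hx) ?_ t
  have := hL.dist_le_mul _ ⟨x, hx, rfl⟩ _ ⟨z, hz, rfl⟩
  rw [Real.dist_eq, dist_comm, dist_eq_norm] at this
  exact this

theorem ofReal_mul_rpow_of_pos {u : ℝ} (hu : 0 < u) (a p : ℝ) :
    ENNReal.ofReal (a * u ^ p) = ENNReal.ofReal a * ENNReal.ofReal u ^ p := by
  rw [ENNReal.ofReal_mul' (Real.rpow_nonneg hu.le p), ENNReal.ofReal_rpow_of_pos hu]

/-- The unnormalized inequality on a ball, for `φ + ε` in place of `φ`. -/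
theorem brascamp_lieb_closedBall {β : ℝ} (hβ : n < β) (hV : ConvexOn ℝ Set.univ V)
    (hV0 : ∀ z, 0 ≤ V z) (hφ : ContDiff ℝ 2 φ) (hc : ConvexOn ℝ Set.univ φ) (hφ0 : ∀ z, 0 ≤ φ z)
    (hHess : ∀ᵐ z : EuclideanSpace ℝ (Fin n), (hess φ z).IsInvertible)
    {R ε : ℝ} (hR : 0 < R) (hε : 0 < ε) :
    ENNReal.ofReal (β + 1) *
        ((∫⁻ z in Metric.closedBall 0 R, ENNReal.ofReal (V (gradient φ z) ^ 2) *
          ENNReal.ofReal (φ z + ε) ^ (-β - 2)) *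
        ∫⁻ z in Metric.closedBall 0 R, ENNReal.ofReal (φ z + ε) ^ (-β)) ≤
      (∫⁻ z in Metric.closedBall 0 R, ENNReal.ofReal (φ z + ε) ^ (-β)) *
        (∫⁻ z in Metric.closedBall 0 R,
          ENNReal.ofReal (hessEnergy φ (fun z => V (gradient φ z)) z) *
          ENNReal.ofReal (φ z + ε) ^ (-β - 1)) +
      ENNReal.ofReal ((1 + 1 / (β - n)) * β) *
        (∫⁻ z in Metric.closedBall 0 R, ENNReal.ofReal (V (gradient φ z)) *
          ENNReal.ofReal (φ z + ε) ^ (-β - 1)) ^ 2 := by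
  have hβ0 : 0 < β := lt_of_le_of_lt n.cast_nonneg hβ
  have hβn : 0 < β - n := sub_pos.2 hβ
  set K := Metric.closedBall (0 : EuclideanSpace ℝ (Fin n)) R with hK
  have hKc : IsCompact K := isCompact_closedBall _ _
  have hvol : volume K ≠ 0 := (Metric.measure_closedBall_pos volume 0 hR).ne'
  set ψ : EuclideanSpace ℝ (Fin n) → ℝ := fun z => φ z + ε with hψ
  set g : EuclideanSpace ℝ (Fin n) → ℝ := fun z => V (gradient φ z) with hg
  have hgr : gradient ψ = gradient φ := gradient_add_const φ ε
  have hhess : hess ψ = hess φ := by ext1 z; simp only [hess, hgr]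
  have hψ2 : ContDiff ℝ 2 ψ := hφ.add contDiff_const
  have hψc : ConvexOn ℝ Set.univ ψ := hc.add (convexOn_const ε convex_univ)
  have hlow : ∀ z, ε ≤ ψ z := fun z => by simp [hψ, hφ0 z]
  have hψpos : ∀ z, 0 < ψ z := fun z => hε.trans_le (hlow z)
  have hgc : Continuous g := (locallyLipschitz_comp_gradient hV hφ).continuous
  obtain ⟨N, hN0, hN⟩ := exists_neg_bregman_sub_le hV hφ hc R
  have hbreg : ∀ z x, bregman ψ z x = bregman φ z x := fun z x => by
    unfold bregman; rw [hgr]; simp only [hψ]; ring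
  have hgood : ∀ᵐ z ∂volume.restrict K, (hess ψ z).IsInvertible ∧ DifferentiableAt ℝ g z := by
    refine ae_restrict_of_ae ?_
    rw [hhess]
    exact hHess.and (ae_differentiableAt_comp_gradient hV hφ)
  have hen : hessEnergy ψ g = hessEnergy φ g := by ext z; simp only [hessEnergy, hhess]
  have hA := integrableOn_rpow hψ2.continuous hKc hψpos (-β)
  have hB := integrableOn_mul_rpow hψ2.continuous hKc hψpos hgc (-β - 1)
  have hC := integrableOn_mul_rpow hψ2.continuous hKc hψpos (h := fun z => g z ^ 2)
    (by fun_prop) (-β - 2)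
  have hp : ∀ (p : ℝ) z, 0 ≤ ψ z ^ p := fun p z => Real.rpow_nonneg (hψpos z).le p
  have hg0 : ∀ z, 0 ≤ g z := fun z => hV0 _
  have eA : ∫⁻ z in K, ENNReal.ofReal (ψ z) ^ (-β) = ENNReal.ofReal (∫ z in K, ψ z ^ (-β)) := by
    rw [ofReal_integral_eq_lintegral_ofReal hA (Eventually.of_forall fun z => hp _ z)]
    exact lintegral_congr fun z => ENNReal.ofReal_rpow_of_pos (hψpos z)
  have eB : ∫⁻ z in K, ENNReal.ofReal (g z) * ENNReal.ofReal (ψ z) ^ (-β - 1) =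
      ENNReal.ofReal (∫ z in K, g z * ψ z ^ (-β - 1)) := by
    rw [ofReal_integral_eq_lintegral_ofReal hB
      (Eventually.of_forall fun z => mul_nonneg (hg0 z) (hp _ z))]
    exact lintegral_congr fun z => (ofReal_mul_rpow_of_pos (hψpos z) _ _).symm
  have eC : ∫⁻ z in K, ENNReal.ofReal (g z ^ 2) * ENNReal.ofReal (ψ z) ^ (-β - 2) =
      ENNReal.ofReal (∫ z in K, g z ^ 2 * ψ z ^ (-β - 2)) := by
    rw [ofReal_integral_eq_lintegral_ofReal hC
      (Eventually.of_forall fun z => mul_nonneg (sq_nonneg _) (hp _ z))]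
    exact lintegral_congr fun z => (ofReal_mul_rpow_of_pos (hψpos z) _ _).symm
  have eD : ∫⁻ z in K, ENNReal.ofReal (hessEnergy φ g z) * ENNReal.ofReal (ψ z) ^ (-β - 1) =
      ∫⁻ z in K, ENNReal.ofReal (hessEnergy ψ g z * ψ z ^ (-β - 1)) := by
    rw [hen]
    exact lintegral_congr fun z => (ofReal_mul_rpow_of_pos (hψpos z) _ _).symm
  change ENNReal.ofReal (β + 1) *
      ((∫⁻ z in K, ENNReal.ofReal (g z ^ 2) * ENNReal.ofReal (ψ z) ^ (-β - 2)) *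
      ∫⁻ z in K, ENNReal.ofReal (ψ z) ^ (-β)) ≤
    (∫⁻ z in K, ENNReal.ofReal (ψ z) ^ (-β)) *
      (∫⁻ z in K, ENNReal.ofReal (hessEnergy φ g z) * ENNReal.ofReal (ψ z) ^ (-β - 1)) +
    ENNReal.ofReal ((1 + 1 / (β - n)) * β) *
      (∫⁻ z in K, ENNReal.ofReal (g z) * ENNReal.ofReal (ψ z) ^ (-β - 1)) ^ 2
  rw [eA, eB, eC, eD]
  have hA0 : 0 ≤ ∫ z in K, ψ z ^ (-β) := integral_nonneg fun z => hp _ z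
  have hB0 : 0 ≤ ∫ z in K, g z * ψ z ^ (-β - 1) :=
    integral_nonneg fun z => mul_nonneg (hg0 z) (hp _ z)
  have hC0 : 0 ≤ ∫ z in K, g z ^ 2 * ψ z ^ (-β - 2) :=
    integral_nonneg fun z => mul_nonneg (sq_nonneg _) (hp _ z)
  by_cases hD : ∫⁻ z in K, ENNReal.ofReal (hessEnergy ψ g z * ψ z ^ (-β - 1)) = ∞
  · rw [hD]
    rcases hA0.eq_or_lt with h0 | h0
    · rw [← h0]; simp
    · rw [ENNReal.mul_top (by simpa using h0), top_add]; exact le_top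
  have key := brascamp_lieb_compact_real hβ hψ2 hψc hgc hKc (convex_closedBall _ _) hvol hε hlow
    hgood hN0 (fun t z hz x hx => by rw [hbreg]; exact hN t z hz x hx) hD
  rw [← ENNReal.ofReal_toReal hD, ← ENNReal.ofReal_pow hB0, ← ENNReal.ofReal_mul hC0,
    ← ENNReal.ofReal_mul (by positivity), ← ENNReal.ofReal_mul hA0,
    ← ENNReal.ofReal_mul (by positivity), ← ENNReal.ofReal_add (by positivity) (by positivity)]
  refine ENNReal.ofReal_le_ofReal ?_
  linarith

/-- Monotone convergence for the simultaneous limits of growing balls and vanishing shift. -/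
theorem tendsto_setLIntegral_closedBall {a : EuclideanSpace ℝ (Fin n) → ℝ≥0∞} (ha : Measurable a)
    (hat : ∀ z, a z ≠ ∞) (hφ : Continuous φ) {p : ℝ} (hp : p < 0) :
    Tendsto (fun k : ℕ => ∫⁻ z in Metric.closedBall 0 ((k : ℝ) + 1),
      a z * ENNReal.ofReal (φ z + 1 / ((k : ℝ) + 1)) ^ p) atTop
      (𝓝 (∫⁻ z, a z * ENNReal.ofReal (φ z) ^ p)) := by
  have hm : ∀ k : ℕ, Measurable fun z => a z * ENNReal.ofReal (φ z + 1 / ((k : ℝ) + 1)) ^ p :=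
    fun k => by
      have := hφ.measurable
      fun_prop
  have hb : ∀ k : ℕ, MeasurableSet
      (Metric.closedBall (0 : EuclideanSpace ℝ (Fin n)) ((k : ℝ) + 1)) := fun k =>
    Metric.isClosed_closedBall.measurableSet
  simp_rw [← lintegral_indicator (hb _)]
  refine lintegral_tendsto_of_tendsto_of_monotone
    (fun k => ((hm k).indicator (hb k)).aemeasurable) ?_ ?_
  · refine Eventually.of_forall fun z k l hkl => ?_
    have hkl' : (k : ℝ) + 1 ≤ (l : ℝ) + 1 := by
      have : (k : ℝ) ≤ l := by exact_mod_cast hkl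
      linarith
    refine (Set.indicator_le_indicator_of_subset (Metric.closedBall_subset_closedBall hkl')
      (fun _ => zero_le) z).trans (Set.indicator_le_indicator ?_)
    have h1 : ENNReal.ofReal (φ z + 1 / ((l : ℝ) + 1)) ≤
        ENNReal.ofReal (φ z + 1 / ((k : ℝ) + 1)) := by
      refine ENNReal.ofReal_le_ofReal ?_
      gcongr
    refine mul_le_mul_right ?_ _
    rw [← neg_neg p, ENNReal.rpow_neg, ENNReal.rpow_neg _ (-p), ENNReal.inv_le_inv]
    exact ENNReal.rpow_le_rpow h1 (by linarith)
  · refine Eventually.of_forall fun z => ?_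
    have h1 : Tendsto (fun k : ℕ => a z * ENNReal.ofReal (φ z + 1 / ((k : ℝ) + 1)) ^ p) atTop
        (𝓝 (a z * ENNReal.ofReal (φ z) ^ p)) := by
      refine ENNReal.Tendsto.const_mul ?_ (Or.inr (hat z))
      refine (ENNReal.continuous_rpow_const.tendsto _).comp (ENNReal.tendsto_ofReal ?_)
      simpa using (tendsto_one_div_add_atTop_nhds_zero_nat (𝕜 := ℝ)).const_add (φ z)
    refine h1.congr' ?_
    obtain ⟨m, hm⟩ := exists_nat_gt ‖z‖
    filter_upwards [eventually_ge_atTop m] with k hk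
    rw [Set.indicator_of_mem]
    rw [mem_closedBall_zero_iff]
    have : (m : ℝ) ≤ k := by exact_mod_cast hk
    linarith

/-- The unnormalized inequality on the whole space. -/
theorem brascamp_lieb_unnormalized {β : ℝ} (hβ : n < β) (hV : ConvexOn ℝ Set.univ V)
    (hV0 : ∀ z, 0 ≤ V z) (hφ : ContDiff ℝ 2 φ) (hc : ConvexOn ℝ Set.univ φ) (hφ0 : ∀ z, 0 ≤ φ z)
    (hHess : ∀ᵐ z : EuclideanSpace ℝ (Fin n), (hess φ z).IsInvertible)
    (hA0 : ∫⁻ z, ENNReal.ofReal (φ z) ^ (-β) ≠ 0) (hAt : ∫⁻ z, ENNReal.ofReal (φ z) ^ (-β) ≠ ∞) :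
    ENNReal.ofReal (β + 1) *
        ((∫⁻ z, ENNReal.ofReal (V (gradient φ z) ^ 2) * ENNReal.ofReal (φ z) ^ (-β - 2)) *
        ∫⁻ z, ENNReal.ofReal (φ z) ^ (-β)) ≤
      (∫⁻ z, ENNReal.ofReal (φ z) ^ (-β)) *
        (∫⁻ z, ENNReal.ofReal (hessEnergy φ (fun z => V (gradient φ z)) z) *
          ENNReal.ofReal (φ z) ^ (-β - 1)) +
      ENNReal.ofReal ((1 + 1 / (β - n)) * β) *
        (∫⁻ z, ENNReal.ofReal (V (gradient φ z)) * ENNReal.ofReal (φ z) ^ (-β - 1)) ^ 2 := by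
  have hβ0 : 0 < β := lt_of_le_of_lt n.cast_nonneg hβ
  have hgc : Continuous fun z => V (gradient φ z) :=
    (locallyLipschitz_comp_gradient hV hφ).continuous
  have hgm := hgc.measurable
  have tC := tendsto_setLIntegral_closedBall (n := n) (φ := φ)
    (a := fun z => ENNReal.ofReal (V (gradient φ z) ^ 2)) (hgm.pow_const 2).ennreal_ofReal
    (fun _ => ENNReal.ofReal_ne_top) hφ.continuous (p := -β - 2) (by linarith)
  have tA := tendsto_setLIntegral_closedBall (n := n) (φ := φ) (a := fun _ => 1) (by fun_prop)
    (fun _ => ENNReal.one_ne_top) hφ.continuous (p := -β) (by linarith)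
  simp only [one_mul] at tA
  refine le_of_tendsto' (ENNReal.Tendsto.const_mul (ENNReal.Tendsto.mul tC (Or.inr hAt) tA
    (Or.inl hA0)) (Or.inr ENNReal.ofReal_ne_top)) fun k => ?_
  have hk : (0 : ℝ) < 1 / ((k : ℝ) + 1) := by positivity
  refine (brascamp_lieb_closedBall hβ hV hV0 hφ hc hφ0 hHess (by positivity) hk).trans ?_
  have hmono : ∀ {a : EuclideanSpace ℝ (Fin n) → ℝ≥0∞} {p : ℝ}, p < 0 →
      ∫⁻ z in Metric.closedBall 0 ((k : ℝ) + 1),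
        a z * ENNReal.ofReal (φ z + 1 / ((k : ℝ) + 1)) ^ p ≤
      ∫⁻ z, a z * ENNReal.ofReal (φ z) ^ p := by
    intro a p hp
    refine (setLIntegral_le_lintegral _ _).trans (lintegral_mono fun z => ?_)
    have h1 : ENNReal.ofReal (φ z) ≤ ENNReal.ofReal (φ z + 1 / ((k : ℝ) + 1)) :=
      ENNReal.ofReal_le_ofReal (by linarith)
    refine mul_le_mul_right ?_ _
    rw [← neg_neg p, ENNReal.rpow_neg, ENNReal.rpow_neg _ (-p), ENNReal.inv_le_inv]
    exact ENNReal.rpow_le_rpow h1 (by linarith)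
  have mA := hmono (a := fun _ => 1) (p := -β) (by linarith)
  simp only [one_mul] at mA
  gcongr ?_ * ?_ + _ * ?_ ^ 2
  · exact hmono (by linarith)
  · exact hmono (by linarith)

end Approximation

/-! ### The normalized measure and the variance -/

section Normalization

variable {n : ℕ} {V φ : EuclideanSpace ℝ (Fin n) → ℝ} {γ : ℝ}

theorem measurable_weight (γ : ℝ) (hφ : Continuous φ) : Measurable (weight γ φ) := by
  have := hφ.measurable
  unfold weight
  fun_prop

/-- The weight is infinite on the zero set of `φ`, which is therefore a null set. -/
theorem ae_pos_of_lintegral_weight_ne_top (hγ0 : γ < 0) (hφ : Continuous φ)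
    (hfin : ∫⁻ z, weight γ φ z ≠ ∞) : ∀ᵐ z, 0 < φ z := by
  filter_upwards [ae_lt_top (measurable_weight γ hφ) hfin] with z hz
  by_contra h
  rw [weight, ENNReal.ofReal_eq_zero.2 (not_lt.1 h), ENNReal.zero_rpow_of_neg] at hz
  · exact lt_irrefl _ hz
  · exact one_div_neg.2 hγ0

theorem lintegral_weight_ne_zero (hγ0 : γ < 0) (hφ : Continuous φ) :
    ∫⁻ z, weight γ φ z ≠ 0 := by
  have h : ∀ z, weight γ φ z ≠ 0 := fun z => by
    simp [weight, ENNReal.rpow_eq_zero_iff, not_lt.2 hγ0.le]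
  intro h0
  rw [lintegral_eq_zero_iff (measurable_weight γ hφ)] at h0
  have : ∀ᵐ _ : EuclideanSpace ℝ (Fin n), False := by
    filter_upwards [h0] with z hz using h z hz
  have h1 : (volume : Measure (EuclideanSpace ℝ (Fin n))) = 0 := by simpa using this
  have h2 := isOpen_univ.measure_pos (volume : Measure (EuclideanSpace ℝ (Fin n)))
    Set.univ_nonempty
  simp [h1] at h2

theorem lintegral_weightedMeasure (hφ : Continuous φ)
    (hfin : ∫⁻ z, weight γ φ z ≠ ∞) (f : EuclideanSpace ℝ (Fin n) → ℝ≥0∞) :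
    ∫⁻ z, f z ∂(weightedMeasure γ φ) = (∫⁻ z, weight γ φ z)⁻¹ * ∫⁻ z, weight γ φ z * f z := by
  rw [weightedMeasure, lintegral_smul_measure, smul_eq_mul,
    lintegral_withDensity_eq_lintegral_mul_non_measurable _ (measurable_weight γ hφ)
      (ae_lt_top (measurable_weight γ hφ) hfin)]
  rfl

theorem isProbabilityMeasure_weightedMeasure (hγ0 : γ < 0) (hφ : Continuous φ)
    (hfin : ∫⁻ z, weight γ φ z ≠ ∞) : IsProbabilityMeasure (weightedMeasure γ φ) := by
  refine ⟨?_⟩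
  have := lintegral_weightedMeasure hφ hfin fun _ => 1
  simp only [mul_one, lintegral_one] at this
  rw [this, ENNReal.inv_mul_cancel (lintegral_weight_ne_zero hγ0 hφ) hfin]

theorem weight_mul_ofReal_div {β : ℝ} (hβ : 1 / γ = -β) {z : EuclideanSpace ℝ (Fin n)}
    (hz : 0 < φ z) (a : ℝ) :
    weight γ φ z * ENNReal.ofReal (a / φ z) = ENNReal.ofReal a * ENNReal.ofReal (φ z) ^ (-β - 1) := by
  have h0 : ENNReal.ofReal (φ z) ≠ 0 := by simpa using hz
  rw [weight, hβ, ENNReal.ofReal_div_of_pos hz, ENNReal.rpow_sub _ _ h0 ENNReal.ofReal_ne_top,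
    ENNReal.rpow_one, div_eq_mul_inv, div_eq_mul_inv]
  ring

/-- An unnormalized quadratic moment inequality, rewritten as a bound on the variance of a
nonnegative function under a probability measure. The constant `κ` must not vanish, so that the
bound is infinite when the mean is. -/
theorem evariance_le_of_second_moment_le {Ω : Type*} [MeasurableSpace Ω] {μ : Measure Ω}
    [IsProbabilityMeasure μ] {G : Ω → ℝ} (hG : AEStronglyMeasurable G μ) (hG0 : ∀ x, 0 ≤ G x)
    {e : ℝ≥0∞} {c κ : ℝ} (hκ : 0 < κ)
    (h : ∫⁻ x, ENNReal.ofReal (G x ^ 2) ∂μ ≤ ENNReal.ofReal c * e +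
      ENNReal.ofReal (κ + 1) * (∫⁻ x, ENNReal.ofReal (G x) ∂μ) ^ 2) :
    evariance G μ ≤ ENNReal.ofReal c * e +
      ENNReal.ofReal κ * (∫⁻ x, ENNReal.ofReal (G x) ∂μ) ^ 2 := by
  by_cases hm : ∫⁻ x, ENNReal.ofReal (G x) ∂μ = ∞
  · rw [hm, ENNReal.top_pow two_ne_zero, ENNReal.mul_top (by simpa using hκ), add_top]
    exact le_top
  rw [evariance_def' hG]
  have h1 : ENNReal.ofReal (μ[G] ^ 2) = (∫⁻ x, ENNReal.ofReal (G x) ∂μ) ^ 2 := by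
    rw [integral_eq_lintegral_of_nonneg_ae (Eventually.of_forall hG0) hG,
      ENNReal.ofReal_pow ENNReal.toReal_nonneg, ENNReal.ofReal_toReal hm]
  have h2 : ∀ x, ‖G x‖ₑ ^ 2 = ENNReal.ofReal (G x ^ 2) := fun x => by
    rw [Real.enorm_of_nonneg (hG0 x), ENNReal.ofReal_pow (hG0 x)]
  simp only [h2]
  rw [h1, tsub_le_iff_right]
  refine h.trans (le_of_eq ?_)
  rw [ENNReal.ofReal_add hκ.le zero_le_one, ENNReal.ofReal_one, add_mul, one_mul, add_assoc]

end Normalization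

theorem mainTheorem9 (n : ℕ) (hn : 1 ≤ n) (γ s : ℝ)
    (hγ : -1 / (n : ℝ) < γ) (hγ0 : γ < 0) (hs : s = γ / (1 + γ * n))
    (V φ : EuclideanSpace ℝ (Fin n) → ℝ)
    (hV : ConvexOn ℝ Set.univ V) (hV0 : ∀ z, 0 ≤ V z)
    (hVlim : Tendsto (fun z => V z / ‖z‖) (cocompact (EuclideanSpace ℝ (Fin n))) atTop)
    (hφ : ConvexOn ℝ Set.univ φ) (hφ0 : ∀ z, 0 ≤ φ z)
    (hφ2 : ContDiff ℝ 2 φ)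
    (hHess : ∀ᵐ z : EuclideanSpace ℝ (Fin n), (hess φ z).IsInvertible)
    (hfin : ∫⁻ z, weight γ φ z ≠ ∞) :
    evariance (testFun V φ) (weightedMeasure γ φ) ≤
      ENNReal.ofReal (-(γ / (1 - γ))) *
          (∫⁻ z, ENNReal.ofReal (energyDensity φ (testFun V φ) z) ∂(weightedMeasure γ φ)) +
        ENNReal.ofReal ((γ - s) / (1 - γ)) *
          (∫⁻ z, ENNReal.ofReal (testFun V φ z) ∂(weightedMeasure γ φ)) ^ 2 := by
  have hn0 : (0 : ℝ) < n := by exact_mod_cast hn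
  obtain ⟨β, hβdef⟩ : ∃ β, β = -(1 / γ) := ⟨_, rfl⟩
  have hβγ : 1 / γ = -β := by rw [hβdef]; ring
  have hγβ : γ = -(1 / β) := by
    rw [hβdef]; field_simp
  have hγn : -1 < γ * n := by rwa [div_lt_iff₀ hn0] at hγ
  have hβ0 : 0 < β := by rw [hβdef]; exact neg_pos.2 (one_div_neg.2 hγ0)
  have hβ : (n : ℝ) < β := by
    have h1 : γ * β = -1 := by rw [hβdef, mul_neg, mul_one_div_cancel hγ0.ne]
    nlinarith
  have hβn : 0 < β - n := sub_pos.2 hβ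
  have hφc := hφ2.continuous
  have hpos := ae_pos_of_lintegral_weight_ne_top hγ0 hφc hfin
  have hZ0 := lintegral_weight_ne_zero hγ0 hφc
  have := isProbabilityMeasure_weightedMeasure hγ0 hφc hfin
  have hw : ∀ z, weight γ φ z = ENNReal.ofReal (φ z) ^ (-β) := fun z => by rw [weight, hβγ]
  have hgc : Continuous fun z => V (gradient φ z) :=
    (locallyLipschitz_comp_gradient hV hφ2).continuous
  have hGm : Measurable (testFun V φ) := hgc.measurable.div hφc.measurable
  have hG0 : ∀ z, 0 ≤ testFun V φ z := fun z => div_nonneg (hV0 _) (hφ0 z)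
  have key := brascamp_lieb_unnormalized hβ hV hV0 hφ2 hφ hφ0 hHess
    (by simpa only [hw] using hZ0) (by simpa only [hw] using hfin)
  simp only [← hw] at key
  set Z := ∫⁻ z, weight γ φ z with hZ
  -- The three integrals of the unnormalized inequality, expressed through the measure `μ`.
  have e1 : ∫⁻ z, ENNReal.ofReal (testFun V φ z) ∂(weightedMeasure γ φ) =
      Z⁻¹ * ∫⁻ z, ENNReal.ofReal (V (gradient φ z)) * ENNReal.ofReal (φ z) ^ (-β - 1) := by
    rw [lintegral_weightedMeasure hφc hfin]
    congr 1
    refine lintegral_congr_ae ?_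
    filter_upwards [hpos] with z hz
    exact weight_mul_ofReal_div hβγ hz _
  have e2 : ∫⁻ z, ENNReal.ofReal (testFun V φ z ^ 2) ∂(weightedMeasure γ φ) =
      Z⁻¹ * ∫⁻ z, ENNReal.ofReal (V (gradient φ z) ^ 2) * ENNReal.ofReal (φ z) ^ (-β - 2) := by
    rw [lintegral_weightedMeasure hφc hfin]
    congr 1
    refine lintegral_congr_ae ?_
    filter_upwards [hpos] with z hz
    have h0 : ENNReal.ofReal (φ z) ≠ 0 := by simpa using hz
    have h1 : testFun V φ z ^ 2 = V (gradient φ z) ^ 2 / φ z / φ z := by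
      unfold testFun; field_simp
    rw [h1, weight_mul_ofReal_div hβγ hz, ENNReal.ofReal_div_of_pos hz,
      show -β - 2 = -β - 1 - 1 by ring, ENNReal.rpow_sub (-β - 1) 1 h0 ENNReal.ofReal_ne_top,
      ENNReal.rpow_one, div_eq_mul_inv, div_eq_mul_inv]
    ring
  have e3 : ∫⁻ z, ENNReal.ofReal (energyDensity φ (testFun V φ) z) ∂(weightedMeasure γ φ) =
      Z⁻¹ * ∫⁻ z, ENNReal.ofReal (hessEnergy φ (fun z => V (gradient φ z)) z) *
        ENNReal.ofReal (φ z) ^ (-β - 1) := by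
    rw [lintegral_weightedMeasure hφc hfin]
    congr 1
    refine lintegral_congr_ae ?_
    filter_upwards [hpos] with z hz
    -- Near a point where `φ` is positive, the quotient `V(∇φ) / φ` is not a junk value.
    have hev : (fun x => testFun V φ x * φ x) =ᶠ[𝓝 z] fun x => V (gradient φ x) := by
      filter_upwards [hφc.continuousAt.eventually_const_lt hz] with x hx
      exact div_mul_cancel₀ _ hx.ne'
    have hgr : gradient (fun x => testFun V φ x * φ x) z =
        gradient (fun x => V (gradient φ x)) z := by
      unfold gradient
      rw [hev.fderiv_eq]
      rfl
    rw [energyDensity, hgr]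
    exact weight_mul_ofReal_div hβγ hz _
  set B := ∫⁻ z, ENNReal.ofReal (V (gradient φ z)) * ENNReal.ofReal (φ z) ^ (-β - 1)
  set C := ∫⁻ z, ENNReal.ofReal (V (gradient φ z) ^ 2) * ENNReal.ofReal (φ z) ^ (-β - 2)
  set D := ∫⁻ z, ENNReal.ofReal (hessEnergy φ (fun z => V (gradient φ z)) z) *
        ENNReal.ofReal (φ z) ^ (-β - 1)
  have h4 : 1 - -(1 / β) = (β + 1) / β := by field_simp; ring
  have hγ1 : -(γ / (1 - γ)) = 1 / (β + 1) := by
    rw [hγβ, h4]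
    field_simp
  have hκ : (γ - s) / (1 - γ) + 1 = 1 / (β + 1) * ((1 + 1 / (β - n)) * β) := by
    have h1 : β + 1 ≠ 0 := by positivity
    have h2 : β - n ≠ 0 := hβn.ne'
    have h3 : 1 + -(1 / β) * (n : ℝ) = (β - n) / β := by field_simp; ring
    rw [hs, hγβ, h3, h4]
    field_simp
    ring
  have hκ0 : 0 < (γ - s) / (1 - γ) := by
    have h1 : (γ - s) / (1 - γ) = n / ((β - n) * (β + 1)) := by
      rw [eq_sub_of_add_eq hκ]
      have h2 : β - n ≠ 0 := hβn.ne'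
      field_simp
      ring
    rw [h1]
    positivity
  refine evariance_le_of_second_moment_le hGm.aestronglyMeasurable hG0 hκ0 ?_
  rw [e1, e2, e3, hγ1, hκ, ENNReal.ofReal_mul (by positivity)]
  set b := ENNReal.ofReal (β + 1)
  have hb : ENNReal.ofReal (1 / (β + 1)) = b⁻¹ := by
    rw [one_div, ENNReal.ofReal_inv_of_pos (by positivity)]
  have hb0 : b ≠ 0 := by
    simp only [b, ne_eq, ENNReal.ofReal_eq_zero, not_le]
    positivity
  have hZZ : Z * Z⁻¹ = 1 := ENNReal.mul_inv_cancel hZ0 hfin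
  have hbb : b * b⁻¹ = 1 := ENNReal.mul_inv_cancel hb0 ENNReal.ofReal_ne_top
  rw [hb]
  set k := ENNReal.ofReal ((1 + 1 / (β - n)) * β)
  calc Z⁻¹ * C = (b * b⁻¹) * (Z * Z⁻¹) * (Z⁻¹ * C) := by rw [hZZ, hbb, one_mul, one_mul]
    _ = b⁻¹ * (Z⁻¹ * Z⁻¹) * (b * (C * Z)) := by ring
    _ ≤ b⁻¹ * (Z⁻¹ * Z⁻¹) * (Z * D + k * B ^ 2) := mul_le_mul_right key _
    _ = b⁻¹ * ((Z * Z⁻¹) * (Z⁻¹ * D)) + b⁻¹ * k * (Z⁻¹ * B) ^ 2 := by ring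
    _ = b⁻¹ * (Z⁻¹ * D) + b⁻¹ * k * (Z⁻¹ * B) ^ 2 := by rw [hZZ, one_mul]
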